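/- Consider a system of $K$ server chains, sorted so that their service rates satisfy $\mu_1\ge\dots\ge\mu_K>0$; chain $l$ has capacity $c_l\in\mathbb{N}$, i.e., it can serve at most $c_l$ jobs at a time. Jobs arrive according to a Poisson process of rate $\lambda>0$, and the service times on chain $l$ are independent of each other and of the arrivals and exponentially distributed with mean $1/\mu_l$. Under Join-the-Fastest-Free-Chain (JFFC), an arriving job is assigned to the fastest chain $l$ (smallest index) that serves fewer than $c_l$ jobs, and joins the end of a central first-come-first-served queue if there is no such chain; upon a completion on chain $l$, the first queued job, if any, is assigned to chain $l$. Let $Z_0$ be the number of queued jobs and $Z_l$ ($1\le l\le K$) the number of jobs in service on chain $l$. Then $\bm Z=(Z_0,\dots,Z_K)$ is a continuous-time Markov chain on the set of $\bm z\in\mathbb{N}^{K+1}$ with $z_l\le c_l$ for all $l\geq 1$, and $z_l=c_l$ for all $l\ge1$ whenever $z_0>0$. Let $\nu:=\sum_{l=1}^K c_l\mu_l$, $C:=\sum_{l=1}^K c_l$, $\rho:=\lambda/\nu$, and, with $(x)_+:=\max(x,0)$, $$\overline{\nu}_n:=\sum_{l=1}^K\mu_l\min\Big(c_l,\Big(n-\sum_{l'=1}^{l-1}c_{l'}\Big)_+\Big),\qquad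 \underline{\nu}_n:=\sum_{l=1}^K\mu_l\min\Big(c_l,\Big(n-\sum_{l'=l+1}^{K}c_{l'}\Big)_+\Big).$$ For $n=0,\dots,C$ let $$\underline{\phi}_n:=\left(1+\sum_{l=1}^{C-1}\frac{\lambda^l}{\prod_{i=1}^l\overline{\nu}_i}+\frac{\lambda^C\nu}{\big(\prod_{i=1}^C\overline{\nu}_i\big)(\nu-\lambda)}\right)^{-1}\prod_{i=1}^n\frac{\lambda}{\overline{\nu}_i},$$ and define $\overline{\phi}_n$ in the same way with $\underline{\nu}_i$ in place of $\overline{\nu}_i$. Put $$\underline{B}:=\sum_{n=0}^{C-1}n\underline{\phi}_n+\underline{\phi}_C\left(\frac{\rho}{(1-\rho)^2}+\frac{C}{1-\rho}\right),\qquad \overline{B}:=\sum_{n=0}^{C-1}n\overline{\phi}_n+\overline{\phi}_C\left(\frac{\rho}{(1-\rho)^2}+\frac{C}{1-\rho}\right).$$ **Theorem.** Suppose that $\lambda<\nu$. Then: 1. The birth–death process on $\mathbb{N}$ with birth rate $\lambda$ and death rates $\overline{\nu}_n$ ($n\ge1$) has a unique stationary distribution; its probabilities for $n=0,\dots,C$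 are $\underline{\phi}_n$ and its mean is $\underline{B}$. Likewise, the birth–death process with birth rate $\lambda$ and death rates $\underline{\nu}_n$ has a unique stationary distribution; its probabilities for $n=0,\dots,C$ are $\overline{\phi}_n$ and its mean is $\overline{B}$. 2. The Markov chain $\bm Z$ has a unique stationary distribution $\bm\pi$, and the steady-state mean number of jobs in the system is finite and satisfies $$\underline{B}\le\mathbb{E}_{\bm\pi}\Big[\sum_{l=0}^K Z_l\Big]\le\overline{B}.$$ 3. The response time (waiting time plus service time) of a job arriving in steady state has finite mean $\overline{T}$, which satisfies Little's law $\overline{T}=\mathbb{E}_{\bm\pi}\big[\sum_{l=0}^K Z_l\big]/\lambda$; hence $\underline{B}/\lambda\le\overline{T}\le\overline{B}/\lambda$. -/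

import Mathlib

open MeasureTheory ProbabilityTheory

/-- `π` is a stationary (steady-state) distribution of the continuous-time Markov chain on `S` whose
transition rate from `s` to `s' ≠ s` is `q s s'`: it is a probability distribution, and for every
state `s` the rate of flow into `s` equals the rate of flow out of `s`. -/
def IsStationaryDistribution {S : Type*} (q : S → S → ℝ) (π : S → ℝ) : Prop :=
  (∀ s, 0 ≤ π s) ∧ HasSum π 1 ∧
    ∀ s, ∃ r, HasSum (fun s' => q s s') r ∧ HasSum (fun s' => π s' * q s' s) (π s * r)

/-- Transition rates of the birth–death process on `ℕ` with birth rate `lam` in every state and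
death rate `d n` in state `n ≥ 1`. -/
def birthDeathRate (lam : ℝ) (d : ℕ → ℝ) (n m : ℕ) : ℝ :=
  if m = n + 1 then lam else if n = m + 1 then d n else 0

namespace JFFC

/-- A state of the system: `queue` jobs wait in the central queue and `jobs l` jobs are in service
on chain `l`, whose capacity is `c l`. Jobs wait only when all the chains are fully occupied. -/
@[ext]
structure State {K : ℕ} (c : Fin K → ℕ) where
  queue : ℕ
  jobs : Fin K → ℕ
  jobs_le : ∀ l, jobs l ≤ c l
  full_of_queue : queue ≠ 0 → jobs = c

namespace State

variable {K : ℕ} {c : Fin K → ℕ}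

/-- Total number of jobs in the system. -/
def total (z : State c) : ℕ := z.queue + ∑ l, z.jobs l

/-- Some chain has available capacity. -/
def HasFree (z : State c) : Prop := ∃ l, z.jobs l < c l

/-- The fastest chain with available capacity (the chains are indexed from fastest to slowest). -/
def fastestFree (z : State c) (h : z.HasFree) : Fin K :=
  (Finset.univ.filter fun l => z.jobs l < c l).min' (by
    obtain ⟨l, hl⟩ := h
    exact ⟨l, by simpa using hl⟩)

theorem jobs_fastestFree_lt (z : State c) (h : z.HasFree) :
    z.jobs (z.fastestFree h) < c (z.fastestFree h) := by
  have := Finset.min'_mem (Finset.univ.filter fun l => z.jobs l < c l) (by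
    obtain ⟨l, hl⟩ := h
    exact ⟨l, by simpa using hl⟩)
  simpa [fastestFree] using this

theorem queue_eq_zero (z : State c) (h : z.HasFree) : z.queue = 0 := by
  by_contra hq
  obtain ⟨l, hl⟩ := h
  rw [z.full_of_queue hq] at hl
  exact lt_irrefl _ hl

theorem jobs_eq (z : State c) (h : ¬ z.HasFree) : z.jobs = c := by
  funext l
  by_contra hl
  exact h ⟨l, lt_of_le_of_ne (z.jobs_le l) hl⟩

open Classical in
/-- The state right after an arrival in state `z`: the new job is assigned to the fastest chain
with available capacity if there is one, and is added to the central queue otherwise. -/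
noncomputable def arrive (z : State c) : State c :=
  if h : z.HasFree then
    { queue := z.queue
      jobs := Function.update z.jobs (z.fastestFree h) (z.jobs (z.fastestFree h) + 1)
      jobs_le := by
        intro l
        by_cases hl : l = z.fastestFree h
        · subst hl
          simpa using z.jobs_fastestFree_lt h
        · simpa [hl] using z.jobs_le l
      full_of_queue := fun hq => absurd (z.queue_eq_zero h) hq }
  else
    { queue := z.queue + 1
      jobs := z.jobs
      jobs_le := z.jobs_le
      full_of_queue := fun _ => z.jobs_eq h }

/-- The state right after the completion of a job on chain `l` in state `z`: the first queued job
is assigned to chain `l` if the central queue is non-empty. (Only used with `z.jobs l ≥ 1`, as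
completions on chain `l` occur at rate `z.jobs l * μ l`.) -/
def complete (z : State c) (l : Fin K) : State c :=
  if hq : z.queue = 0 then
    { queue := 0
      jobs := Function.update z.jobs l (z.jobs l - 1)
      jobs_le := by
        intro l'
        by_cases hl : l' = l
        · subst hl
          simpa using (Nat.sub_le _ _).trans (z.jobs_le l')
        · simpa [hl] using z.jobs_le l'
      full_of_queue := fun h => absurd rfl h }
  else
    { queue := z.queue - 1
      jobs := z.jobs
      jobs_le := z.jobs_le
      full_of_queue := fun _ => z.full_of_queue hq }

end State

open Classical in
/-- Transition rate from `z` to `z'` under Join-the-Fastest-Free-Chain: arrivals form a Poisson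
process of rate `lam`, and each of the `z.jobs l` jobs in service on chain `l` completes at
rate `μ l`. -/
noncomputable def rate {K : ℕ} (lam : ℝ) (μ : Fin K → ℝ) (c : Fin K → ℕ) (z z' : State c) : ℝ :=
  (if z' = z.arrive then lam else 0) +
    ∑ l, if z' = z.complete l then (z.jobs l : ℝ) * μ l else 0

/-- Total service rate `ν`. -/
def totalRate {K : ℕ} (μ : Fin K → ℝ) (c : Fin K → ℕ) : ℝ := ∑ l, (c l : ℝ) * μ l

/-- Total capacity `C`. -/
def totalCapacity {K : ℕ} (c : Fin K → ℕ) : ℕ := ∑ l, c l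

/-- Departure rate when `n` jobs run on the fastest chains. The subtraction in `ℕ` is the positive
part of the difference. -/
def fastDeathRate {K : ℕ} (μ : Fin K → ℝ) (c : Fin K → ℕ) (n : ℕ) : ℝ :=
  ∑ l, μ l * (min (c l) (n - ∑ l' ∈ Finset.Iio l, c l') : ℕ)

/-- Departure rate when `n` jobs run on the slowest chains. The subtraction in `ℕ` is the positive
part of the difference. -/
def slowDeathRate {K : ℕ} (μ : Fin K → ℝ) (c : Fin K → ℕ) (n : ℕ) : ℝ :=
  ∑ l, μ l * (min (c l) (n - ∑ l' ∈ Finset.Ioi l, c l') : ℕ)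

/-- The closed-form probabilities `φ_n`, `0 ≤ n ≤ C`, for arrival rate `lam`, total service rate
`ν`, total capacity `C` and death rates `d`. -/
noncomputable def phi (lam ν : ℝ) (C : ℕ) (d : ℕ → ℝ) (n : ℕ) : ℝ :=
  (1 + ∑ l ∈ Finset.Icc 1 (C - 1), lam ^ l / ∏ i ∈ Finset.Icc 1 l, d i
      + lam ^ C * ν / ((∏ i ∈ Finset.Icc 1 C, d i) * (ν - lam)))⁻¹
    * ∏ i ∈ Finset.Icc 1 n, lam / d i

/-- The closed-form mean `∑_{n<C} n φ_n + φ_C (ρ / (1 - ρ)² + C / (1 - ρ))` with `ρ = lam / ν`. -/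
noncomputable def meanFormula (lam ν : ℝ) (C : ℕ) (d : ℕ → ℝ) : ℝ :=
  ∑ n ∈ Finset.range C, (n : ℝ) * phi lam ν C d n +
    phi lam ν C d C * ((lam / ν) / (1 - lam / ν) ^ 2 + (C : ℝ) / (1 - lam / ν))

/-- The lower bound on the mean number of jobs: the closed-form mean for the death rates
`fastDeathRate`. -/
noncomputable def lowerBound {K : ℕ} (lam : ℝ) (μ : Fin K → ℝ) (c : Fin K → ℕ) : ℝ :=
  meanFormula lam (totalRate μ c) (totalCapacity c) (fastDeathRate μ c)

/-- The upper bound on the mean number of jobs: the closed-form mean for the death rates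
`slowDeathRate`. -/
noncomputable def upperBound {K : ℕ} (lam : ℝ) (μ : Fin K → ℝ) (c : Fin K → ℕ) : ℝ :=
  meanFormula lam (totalRate μ c) (totalCapacity c) (slowDeathRate μ c)

open Classical in
/-- The law of the response time (time in system) of a job that finds the system in state `z` upon
its arrival. If some chain is free, this is the service time on the fastest free chain. Otherwise
the job waits for `z.queue + 1` completions (those of the jobs ahead of it leaving the queue, and
its own turn), whose successive gaps are independent and exponential with rate
`ν = totalRate μ c`, so that its waiting time is Gamma distributed; the completion that lets it
start occurs, independently of the waiting time, on chain `l` with probability `c l * μ l / ν`, and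
its own service time there is exponential with rate `μ l`. -/
noncomputable def responseLaw {K : ℕ} (μ : Fin K → ℝ) (c : Fin K → ℕ) (z : State c) : Measure ℝ :=
  if h : z.HasFree then expMeasure (μ (z.fastestFree h))
  else (gammaMeasure ((z.queue : ℝ) + 1) (totalRate μ c)).conv
    (∑ l, ENNReal.ofReal ((c l : ℝ) * μ l / totalRate μ c) • expMeasure (μ l))

/-- The law of the response time of a job that arrives in steady state: as the arrivals are Poisson,
the state found by the job has the stationary distribution `π`. -/
noncomputable def steadyResponseLaw {K : ℕ} (μ : Fin K → ℝ) (c : Fin K → ℕ) (π : State c → ℝ) :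
    Measure ℝ :=
  Measure.sum fun z => ENNReal.ofReal (π z) • responseLaw μ c z

end JFFC

/-!
Birth–death processes are solved through detailed balance
(`isStationaryDistribution_birthDeathRate_iff`), which forces the product form
`JFFC.phi` at every level; beyond level `C` it is geometric, so the normalization and the mean are
explicit.

The Markov chain of the system is treated through its balance equations. As the transition rates out
of a state are bounded, the absolute value of a signed solution is again a solution
(`IsBalanced.abs`). This gives uniqueness (`IsStationaryDistribution.unique`), since the state
`full c 0` can be reached from everywhere, and also existence for finite chains, whose generator is
singular. The states without queue form a finite set that communicates with the queue only through
the pair `full c 0`, `full c 1`, so the stationary distribution of the chain restricted to this set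
extends by geometric decay in the queue length.

Boundedness of the rates also shows that bounded functions of the state have mean drift zero in
steady state (`JFFC.hasSum_drift`). Applied to the indicator of `total ≤ n`, this equates the flows
between `n` and `n + 1` jobs. With `n` jobs in the system the departure rate lies between
`slowDeathRate` and `fastDeathRate` (`sum_mul_le_sum_mul_min`), so the ratio of the law of the total
number of jobs to each birth–death law is monotone, and a single-crossing argument
(`mean_le_of_monotone_ratio`) compares the means.

Applied to the number of jobs on one chain, zero mean drift gives Little's law for the jobs that are
served without waiting; for the others it follows from the geometric decay of the queue
(`JFFC.hasSum_mul_meanResponse`). The means of the response laws are computed from the means of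
Gamma distributions, mixtures and convolutions (`IsTimeLaw`).
-/

/-! ### Birth–death processes and comparison of means -/

theorem hasSum_of_sum_eq {α : Type*} {f : α → ℝ} {a : ℝ} (s : Finset α)
    (h : ∀ b ∉ s, f b = 0) (ha : ∑ b ∈ s, f b = a) : HasSum f a :=
  ha ▸ hasSum_sum_of_ne_finset_zero h

theorem hasSum_birthDeathRate (lam : ℝ) (d : ℕ → ℝ) (n : ℕ) :
    HasSum (birthDeathRate lam d n) (lam + if n = 0 then 0 else d n) := by
  have h : ∀ m ∉ ({n + 1, n - 1} : Finset ℕ), birthDeathRate lam d n m = 0 := by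
    intro m hm
    simp only [Finset.mem_insert, Finset.mem_singleton, not_or] at hm
    simp only [birthDeathRate]
    rw [if_neg hm.1, if_neg (by omega)]
  refine hasSum_of_sum_eq _ h ?_
  rw [Finset.sum_pair (by omega)]
  rcases n with _ | n <;> simp [birthDeathRate]
  omega

theorem hasSum_mul_birthDeathRate_zero (lam : ℝ) (d φ : ℕ → ℝ) :
    HasSum (fun m => φ m * birthDeathRate lam d m 0) (φ 1 * d 1) := by
  convert hasSum_single (f := fun m => φ m * birthDeathRate lam d m 0) 1 ?_ using 1
  · simp [birthDeathRate]
  · intro m hm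
    simp only [birthDeathRate]
    rw [if_neg (by omega), if_neg (by omega), mul_zero]

theorem hasSum_mul_birthDeathRate_succ (lam : ℝ) (d φ : ℕ → ℝ) (n : ℕ) :
    HasSum (fun m => φ m * birthDeathRate lam d m (n + 1))
      (φ n * lam + φ (n + 2) * d (n + 2)) := by
  have h : ∀ m ∉ ({n, n + 2} : Finset ℕ), φ m * birthDeathRate lam d m (n + 1) = 0 := by
    intro m hm
    simp only [Finset.mem_insert, Finset.mem_singleton, not_or] at hm
    simp only [birthDeathRate]
    rw [if_neg (by omega), if_neg (by omega), mul_zero]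
  refine hasSum_of_sum_eq _ h ?_
  rw [Finset.sum_pair (by omega)]
  simp [birthDeathRate]

/-- Stationary distributions of a birth–death process are the solutions of the detailed balance
equations: the flow across each cut between `{0, …, n}` and its complement vanishes. -/
theorem isStationaryDistribution_birthDeathRate_iff {lam : ℝ} {d φ : ℕ → ℝ} :
    IsStationaryDistribution (birthDeathRate lam d) φ ↔
      (∀ n, 0 ≤ φ n) ∧ HasSum φ 1 ∧ ∀ n, φ n * lam = φ (n + 1) * d (n + 1) := by
  refine and_congr_right fun _ => and_congr_right fun _ => ⟨fun h n => ?_, fun h n => ?_⟩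
  · induction n with
    | zero =>
      obtain ⟨r, h1, h2⟩ := h 0
      rw [h1.unique (hasSum_birthDeathRate lam d 0)] at h2
      simpa using h2.unique (hasSum_mul_birthDeathRate_zero lam d φ)
    | succ n ih =>
      obtain ⟨r, h1, h2⟩ := h (n + 1)
      rw [h1.unique (hasSum_birthDeathRate lam d (n + 1))] at h2
      have := h2.unique (hasSum_mul_birthDeathRate_succ lam d φ n)
      simp only [Nat.add_eq_zero_iff, one_ne_zero, and_false, if_false] at this
      linear_combination this + ih
  · refine ⟨_, hasSum_birthDeathRate lam d n, ?_⟩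
    rcases n with _ | n
    · convert hasSum_mul_birthDeathRate_zero lam d φ using 1
      simpa using h 0
    · convert hasSum_mul_birthDeathRate_succ lam d φ n using 1
      simp only [Nat.add_eq_zero_iff, one_ne_zero, and_false, if_false]
      linear_combination h (n + 1) - h n

/-- The product of birth/death ratios is geometric beyond level `C` if the death rates are constant
there. -/
theorem prod_div_add {lam ν : ℝ} {C : ℕ} {d : ℕ → ℝ} (hd : ∀ n, C ≤ n → d n = ν) (k : ℕ) :
    ∏ i ∈ Finset.Icc 1 (k + C), lam / d i
      = (∏ i ∈ Finset.Icc 1 C, lam / d i) * (lam / ν) ^ k := by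
  induction k with
  | zero => simp
  | succ k ih =>
    rw [show k + 1 + C = (k + C) + 1 by ring, Finset.prod_Icc_succ_top (by omega), ih,
      hd _ (by omega), pow_succ, mul_assoc]

section

variable {lam ν : ℝ} {C : ℕ} {d : ℕ → ℝ}

/-- The normalizing constant in `JFFC.phi`, as a sum of products of birth/death ratios. -/
theorem hasSum_prod_div (hlam : 0 < lam) (hν : lam < ν) (hC : 1 ≤ C)
    (hd : ∀ n, C ≤ n → d n = ν) :
    HasSum (fun n => ∏ i ∈ Finset.Icc 1 n, lam / d i)
      (1 + ∑ l ∈ Finset.Icc 1 (C - 1), lam ^ l / ∏ i ∈ Finset.Icc 1 l, d i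
        + lam ^ C * ν / ((∏ i ∈ Finset.Icc 1 C, d i) * (ν - lam))) := by
  have hν0 : 0 < ν := hlam.trans hν
  have hρ : lam / ν < 1 := (div_lt_one hν0).2 hν
  have hρ0 : 0 ≤ lam / ν := by positivity
  rw [← hasSum_nat_add_iff' C]
  have h := (hasSum_geometric_of_lt_one hρ0 hρ).mul_left (∏ i ∈ Finset.Icc 1 C, lam / d i)
  simp only [← prod_div_add hd] at h
  refine (congrArg (HasSum _) ?_).mpr h
  obtain ⟨C, rfl⟩ : ∃ m, C = m + 1 := ⟨C - 1, by omega⟩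
  have h1 : ∑ i ∈ Finset.range (C + 1), ∏ i ∈ Finset.Icc 1 i, lam / d i =
      1 + ∑ l ∈ Finset.Icc 1 C, lam ^ l / ∏ i ∈ Finset.Icc 1 l, d i := by
    rw [Finset.sum_range_succ', Finset.range_eq_Ico,
      Finset.sum_Ico_add' (fun i => ∏ i ∈ Finset.Icc 1 i, lam / d i) 0 C 1]
    simp [Finset.prod_div_distrib, add_comm, Finset.Ico_add_one_right_eq_Icc]
  have h2 : ∏ i ∈ Finset.Icc 1 (C + 1), lam / d i
      = lam ^ (C + 1) / ∏ i ∈ Finset.Icc 1 (C + 1), d i := by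
    simp [Finset.prod_div_distrib]
  rw [h1, h2, Nat.add_sub_cancel, one_sub_div hν0.ne', inv_div]
  simp only [add_sub_cancel_left]
  rw [div_mul_div_comm]

theorem prod_div_pos (hlam : 0 < lam) (hd0 : ∀ n, 1 ≤ n → 0 < d n) (n : ℕ) :
    0 < ∏ i ∈ Finset.Icc 1 n, lam / d i :=
  Finset.prod_pos fun i hi => div_pos hlam (hd0 i (Finset.mem_Icc.1 hi).1)

theorem phi_normalizer_pos (hlam : 0 < lam) (hν : lam < ν) (hd0 : ∀ n, 1 ≤ n → 0 < d n) :
    0 < 1 + ∑ l ∈ Finset.Icc 1 (C - 1), lam ^ l / ∏ i ∈ Finset.Icc 1 l, d i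
        + lam ^ C * ν / ((∏ i ∈ Finset.Icc 1 C, d i) * (ν - lam)) := by
  have hν0 : 0 < ν := hlam.trans hν
  have hsub : 0 < ν - lam := sub_pos.2 hν
  have hp : ∀ n, 0 < ∏ i ∈ Finset.Icc 1 n, d i := fun n =>
    Finset.prod_pos fun i hi => hd0 i (Finset.mem_Icc.1 hi).1
  have := Finset.sum_nonneg fun l (_ : l ∈ Finset.Icc 1 (C - 1)) =>
    (div_pos (pow_pos hlam l) (hp l)).le
  have := div_pos (mul_pos (pow_pos hlam C) hν0) (mul_pos (hp C) hsub)
  linarith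

theorem phi_pos (hlam : 0 < lam) (hν : lam < ν) (hd0 : ∀ n, 1 ≤ n → 0 < d n) (n : ℕ) :
    0 < JFFC.phi lam ν C d n :=
  mul_pos (inv_pos.2 (phi_normalizer_pos hlam hν hd0)) (prod_div_pos hlam hd0 n)

theorem phi_mul_eq (hd0 : ∀ n, 1 ≤ n → 0 < d n) (n : ℕ) :
    JFFC.phi lam ν C d n * lam = JFFC.phi lam ν C d (n + 1) * d (n + 1) := by
  have := (hd0 (n + 1) (by omega)).ne'
  simp only [JFFC.phi]
  rw [Finset.prod_Icc_succ_top (by omega)]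
  field_simp

theorem hasSum_phi (hlam : 0 < lam) (hν : lam < ν) (hC : 1 ≤ C)
    (hd : ∀ n, C ≤ n → d n = ν) (hd0 : ∀ n, 1 ≤ n → 0 < d n) :
    HasSum (JFFC.phi lam ν C d) 1 := by
  have h := (hasSum_prod_div hlam hν hC hd).mul_left
    (1 + ∑ l ∈ Finset.Icc 1 (C - 1), lam ^ l / ∏ i ∈ Finset.Icc 1 l, d i
        + lam ^ C * ν / ((∏ i ∈ Finset.Icc 1 C, d i) * (ν - lam)))⁻¹
  rwa [inv_mul_cancel₀ (phi_normalizer_pos hlam hν hd0).ne'] at h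

theorem phi_add (hd : ∀ n, C ≤ n → d n = ν) (k : ℕ) :
    JFFC.phi lam ν C d (k + C) = JFFC.phi lam ν C d C * (lam / ν) ^ k := by
  simp only [JFFC.phi, prod_div_add hd k, mul_assoc]

theorem hasSum_mul_phi (hlam : 0 < lam) (hν : lam < ν) (hd : ∀ n, C ≤ n → d n = ν) :
    HasSum (fun n : ℕ => (n : ℝ) * JFFC.phi lam ν C d n) (JFFC.meanFormula lam ν C d) := by
  have hν0 : 0 < ν := hlam.trans hν
  have hρ : lam / ν < 1 := (div_lt_one hν0).2 hν
  have hρ0 : 0 ≤ lam / ν := by positivity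
  rw [← hasSum_nat_add_iff' C]
  have h1 := hasSum_coe_mul_geometric_of_norm_lt_one (𝕜 := ℝ) (r := lam / ν)
    (by rwa [Real.norm_of_nonneg hρ0])
  have h2 := (hasSum_geometric_of_lt_one hρ0 hρ).mul_left (C : ℝ)
  have h3 := (h1.add h2).mul_left (JFFC.phi lam ν C d C)
  rw [JFFC.meanFormula]
  simp only [add_sub_cancel_left, div_eq_mul_inv (C : ℝ)]
  refine h3.congr_fun ?_
  intro k
  rw [phi_add hd]
  push_cast
  ring

/-- The detailed balance equations determine a distribution up to a factor, and hence, by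
normalization, completely. -/
theorem isStationaryDistribution_birthDeathRate_iff_eq_phi (hlam : 0 < lam) (hν : lam < ν)
    (hC : 1 ≤ C) (hd : ∀ n, C ≤ n → d n = ν) (hd0 : ∀ n, 1 ≤ n → 0 < d n) {φ : ℕ → ℝ} :
    IsStationaryDistribution (birthDeathRate lam d) φ ↔ φ = JFFC.phi lam ν C d := by
  rw [isStationaryDistribution_birthDeathRate_iff]
  constructor
  · rintro ⟨-, h1, h2⟩
    have key : ∀ n, φ n * JFFC.phi lam ν C d 0 = φ 0 * JFFC.phi lam ν C d n := by
      intro n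
      induction n with
      | zero => ring
      | succ n ih =>
        have h3 := phi_mul_eq (lam := lam) (ν := ν) (C := C) hd0 n
        have h4 := hd0 (n + 1) (by omega)
        refine mul_right_cancel₀ h4.ne' ?_
        linear_combination lam * ih - JFFC.phi lam ν C d 0 * h2 n + φ 0 * h3
    have h5 := (h1.mul_right (JFFC.phi lam ν C d 0))
    simp only [key] at h5
    have h6 := h5.unique ((hasSum_phi hlam hν hC hd hd0).mul_left (φ 0))
    have h0 := phi_pos (C := C) hlam hν hd0 0
    funext n
    have := key n
    rw [one_mul, mul_one] at h6
    rw [← h6, mul_comm] at this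
    exact mul_left_cancel₀ h0.ne' this
  · rintro rfl
    exact ⟨fun n => (phi_pos hlam hν hd0 n).le, hasSum_phi hlam hν hC hd hd0, phi_mul_eq hd0⟩

end

/-- If the likelihood ratio `b n / a n` is nondecreasing in `n`, the distribution `b` has the larger
mean. -/
theorem mean_le_of_monotone_ratio {a b : ℕ → ℝ} {A B : ℝ} (hb : ∀ n, 0 < b n)
    (ha1 : HasSum a 1) (hb1 : HasSum b 1) (hA : HasSum (fun n : ℕ => (n : ℝ) * a n) A)
    (hB : HasSum (fun n : ℕ => (n : ℝ) * b n) B)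
    (h : ∀ n, a (n + 1) * b n ≤ a n * b (n + 1)) : A ≤ B := by
  classical
  have hex : ∃ n, a n ≤ b n := by
    by_contra! hcon
    exact lt_irrefl _ (hasSum_lt (fun n => (hcon n).le) (hcon 0) hb1 ha1)
  -- The densities cross only once, at the first index `N` with `a N ≤ b N`.
  have hN : ∀ n, Nat.find hex ≤ n → a n ≤ b n := by
    intro n hn
    induction n, hn using Nat.le_induction with
    | base => exact Nat.find_spec hex
    | succ n _ ih =>
      refine le_of_mul_le_mul_right ?_ (hb n)
      calc _ ≤ a n * b (n + 1) := h n
        _ ≤ b n * b (n + 1) := mul_le_mul_of_nonneg_right ih (hb _).le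
        _ = _ := mul_comm _ _
  have hS := (hB.sub hA).sub ((hb1.sub ha1).mul_left (Nat.find hex : ℝ))
  have := hS.nonneg fun n => ?_
  · linarith
  have h' : (n : ℝ) * b n - n * a n - (Nat.find hex : ℝ) * (b n - a n)
      = ((n : ℝ) - (Nat.find hex : ℝ)) * (b n - a n) := by ring
  rw [h']
  rcases le_or_gt (Nat.find hex) n with hn | hn
  · exact mul_nonneg (sub_nonneg.2 (by exact_mod_cast hn)) (sub_nonneg.2 (hN n hn))
  · exact mul_nonneg_of_nonpos_of_nonpos (sub_nonpos.2 (by exact_mod_cast hn.le))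
      (sub_nonpos.2 (not_le.1 (Nat.find_min hex hn)).le)

/-! ### Stationary distributions of Markov chains with bounded rates -/

section Chain

variable {S : Type*} {q : S → S → ℝ} {r : S → ℝ} {M : ℝ} {x : S → ℝ}

/-- `x` solves the (signed) balance equations of the chain with transition rates `q` and total
outflow rates `r`. -/
def IsBalanced (q : S → S → ℝ) (r x : S → ℝ) : Prop :=
  ∀ s, HasSum (fun s' => x s' * q s' s) (x s * r s)

theorem IsBalanced.add {y : S → ℝ} (hx : IsBalanced q r x) (hy : IsBalanced q r y) :
    IsBalanced q r (x + y) := fun s => by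
  simpa [add_mul] using (hx s).add (hy s)

theorem IsBalanced.smul (hx : IsBalanced q r x) (a : ℝ) : IsBalanced q r (a • x) := fun s => by
  simpa [mul_assoc] using (hx s).mul_left a

theorem IsStationaryDistribution.isBalanced (hr : ∀ s, HasSum (q s) (r s))
    (h : IsStationaryDistribution q x) : IsBalanced q r x := fun s => by
  obtain ⟨r', h1, h2⟩ := h.2.2 s
  rwa [h1.unique (hr s)] at h2

theorem IsBalanced.isStationaryDistribution (hr : ∀ s, HasSum (q s) (r s))
    (hx : IsBalanced q r x) (h0 : ∀ s, 0 ≤ x s) (h1 : HasSum x 1) :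
    IsStationaryDistribution q x :=
  ⟨h0, h1, fun s => ⟨r s, hr s, hx s⟩⟩

theorem summable_prod_mul_rate (hq : ∀ s s', 0 ≤ q s s') (hr : ∀ s, HasSum (q s) (r s))
    (hM : ∀ s, r s ≤ M) (hx : Summable x) :
    Summable fun p : S × S => |x p.1| * q p.1 p.2 := by
  have hs : ∀ s, HasSum (fun s' => |x s| * q s s') (|x s| * r s) := fun s =>
    (hr s).mul_left |x s|
  have h1 : Summable fun s => |x s| * r s :=
    Summable.of_nonneg_of_le (fun s => mul_nonneg (abs_nonneg _) ((hr s).nonneg (hq s)))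
      (fun s => mul_le_mul_of_nonneg_left (hM s) (abs_nonneg _)) (hx.abs.mul_right M)
  rw [summable_prod_of_nonneg]
  · refine ⟨fun s => (hs s).summable, ?_⟩
    simpa only [(hs _).tsum_eq] using h1
  · intro p
    exact mul_nonneg (abs_nonneg _) (hq _ _)

/-- By the triangle inequality, the inflow of `|x|` into any state is at least its outflow; as
the total inflow and outflow agree, so do they in each state. -/
theorem IsBalanced.abs (hq : ∀ s s', 0 ≤ q s s') (hr : ∀ s, HasSum (q s) (r s))
    (hM : ∀ s, r s ≤ M) (hx : Summable x) (hb : IsBalanced q r x) :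
    IsBalanced q r fun s => |x s| := by
  have hS := summable_prod_mul_rate hq hr hM hx
  have hr0 : ∀ s, 0 ≤ r s := fun s => (hr s).nonneg (hq s)
  have hcol : ∀ s, Summable fun s' => |x s'| * q s' s := fun s =>
    hS.prod_symm.prod_factor s
  have hrow : HasSum (fun s => |x s| * r s) (∑' p : S × S, |x p.1| * q p.1 p.2) :=
    hS.hasSum.prod_fiberwise fun s => (hr s).mul_left _
  have hcols : HasSum (fun s => ∑' s', |x s'| * q s' s) (∑' p : S × S, |x p.1| * q p.1 p.2) :=
    ((Equiv.prodComm S S).hasSum_iff.2 hS.hasSum).prod_fiberwise fun s => (hcol s).hasSum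
  have hle : ∀ s, |x s| * r s ≤ ∑' s', |x s'| * q s' s := fun s => by
    rw [← abs_of_nonneg (hr0 s), ← abs_mul, ← (hb s).tsum_eq]
    have h1 : ∀ s', |x s'| * q s' s = ‖x s' * q s' s‖ := fun s' => by
      rw [Real.norm_eq_abs, abs_mul, abs_of_nonneg (hq s' s)]
    have h2 := hcol s
    simp only [h1] at h2 ⊢
    exact norm_tsum_le_tsum_norm h2
  have hz := (hasSum_zero_iff_of_nonneg fun s => sub_nonneg.2 (hle s)).1
    (by simpa using hcols.sub hrow)
  intro s
  have := congrFun hz s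
  simp only [Pi.zero_apply, sub_eq_zero] at this
  exact this ▸ (hcol s).hasSum

/-- Positivity of a nonnegative solution of the balance equations spreads along transitions. -/
theorem IsBalanced.pos_of_reachable (hq : ∀ s s', 0 ≤ q s s') (hb : IsBalanced q r x)
    (hx : ∀ s, 0 ≤ x s) {s t : S} (hst : Relation.ReflTransGen (fun a b => 0 < q a b) s t)
    (hs : 0 < x s) : 0 < x t := by
  induction hst with
  | refl => exact hs
  | @tail a b _ hab ih =>
    refine (hx b).lt_of_ne fun h0 => ?_
    have h1 := le_hasSum (hb b) a fun c _ => mul_nonneg (hx c) (hq c b)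
    rw [← h0, zero_mul] at h1
    exact absurd h1 (not_le.2 (mul_pos ih hab))

/-- If some state `o` can be reached from every state, there is at most one stationary distribution:
the positive and the negative part of the difference of two of them solve the balance equations
too, and if neither vanished, both would be positive at `o`. -/
theorem IsStationaryDistribution.unique (hq : ∀ s s', 0 ≤ q s s') (hr : ∀ s, HasSum (q s) (r s))
    (hM : ∀ s, r s ≤ M) (o : S) (ho : ∀ s, Relation.ReflTransGen (fun a b => 0 < q a b) s o)
    {π₁ π₂ : S → ℝ} (h₁ : IsStationaryDistribution q π₁) (h₂ : IsStationaryDistribution q π₂) :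
    π₁ = π₂ := by
  have hx1 : HasSum (π₁ + (-1 : ℝ) • π₂) 0 := by
    have := h₁.2.1.add (h₂.2.1.mul_left (-1 : ℝ))
    rwa [mul_one, add_neg_cancel] at this
  have hb := (h₁.isBalanced hr).add ((h₂.isBalanced hr).smul (-1))
  set x := π₁ + (-1 : ℝ) • π₂ with hx
  have ha := hb.abs hq hr hM hx1.summable
  have hp := ha.add hb
  have hn := ha.add (hb.smul (-1))
  -- If `x o > 0`, the negative part of `x` vanishes at `o`, hence everywhere; otherwise the
  -- positive part vanishes. As `x` has sum zero, it vanishes.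
  have hpos : 0 < x o → ∀ s, 0 ≤ x s := fun h s => by
    by_contra! hs
    have := hn.pos_of_reachable hq (fun s => by simp [le_abs_self]) (ho s)
      (by simpa using hs.trans_le (abs_nonneg _))
    simp [abs_of_pos h] at this
  have hneg : x o ≤ 0 → ∀ s, x s ≤ 0 := fun h s => by
    by_contra! hs
    have := hp.pos_of_reachable hq
      (fun s => by simpa using neg_le_iff_add_nonneg.1 (neg_le_abs (x s))) (ho s)
      (by simpa using by positivity)
    simp [abs_of_nonpos h] at this
  have hzero : x = 0 := by
    rcases lt_or_ge 0 (x o) with h | h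
    · exact (hasSum_zero_iff_of_nonneg (hpos h)).1 hx1
    · have := (hasSum_zero_iff_of_nonneg (f := -x) fun s => neg_nonneg.2 (hneg h s)).1
        (neg_zero (G := ℝ) ▸ hx1.neg)
      simpa using this
  funext s
  have := congrFun hzero s
  simp [hx] at this
  linarith

/-- The generator of a finite chain annihilates the constants, so it is singular and its transpose
has a nonzero kernel vector `v`; normalizing `|v|` gives a stationary distribution. -/
theorem exists_isStationaryDistribution_of_fintype [Fintype S] [Nonempty S]
    (hq : ∀ s s', 0 ≤ q s s') : ∃ π, IsStationaryDistribution q π := by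
  classical
  set r : S → ℝ := fun s => ∑ s', q s s' with hrdef
  have hr : ∀ s, HasSum (q s) (r s) := fun s => hasSum_fintype _
  let A : Matrix S S ℝ := Matrix.of q - Matrix.diagonal r
  have hA : A.det = 0 := by
    refine Matrix.exists_mulVec_eq_zero_iff.1 ⟨1, one_ne_zero, ?_⟩
    funext s
    rw [Matrix.sub_mulVec, Pi.sub_apply, Matrix.mulVec_diagonal]
    simp [Matrix.mulVec, dotProduct, hrdef]
  obtain ⟨v, hv, hvA⟩ := Matrix.exists_vecMul_eq_zero_iff.2 hA
  have hb : IsBalanced q r v := fun s => by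
    have := congrFun hvA s
    simp only [A, Matrix.vecMul_sub, Pi.sub_apply, Matrix.vecMul_diagonal, Pi.zero_apply,
      sub_eq_zero] at this
    exact this ▸ hasSum_fintype _
  have ha := hb.abs hq hr (M := ∑ s, r s)
    (fun s => Finset.single_le_sum (fun s _ => (hr s).nonneg (hq s)) (Finset.mem_univ s))
    (hasSum_fintype v).summable
  have hpos : 0 < ∑ s, |v s| := by
    obtain ⟨s, hs⟩ := Function.ne_iff.1 hv
    exact Finset.sum_pos' (fun _ _ => abs_nonneg _) ⟨s, Finset.mem_univ s, abs_pos.2 hs⟩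
  refine ⟨_, (ha.smul (∑ s, |v s|)⁻¹).isStationaryDistribution hr
    (fun s => mul_nonneg (inv_nonneg.2 hpos.le) (abs_nonneg _)) ?_⟩
  have := (hasSum_fintype fun s => |v s|).mul_left (∑ s, |v s|)⁻¹
  rwa [inv_mul_cancel₀ hpos.ne'] at this

/-- In a stationary regime, the mean drift of a bounded function of the state is zero. -/
theorem IsBalanced.hasSum_drift (hq : ∀ s s', 0 ≤ q s s') (hr : ∀ s, HasSum (q s) (r s))
    (hM : ∀ s, r s ≤ M) (hx : Summable x) (hb : IsBalanced q r x) {f g : S → ℝ} {B : ℝ}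
    (hf : ∀ s, |f s| ≤ B) (hg : ∀ s, HasSum (fun s' => q s s' * f s') (g s)) :
    HasSum (fun s => x s * (g s - r s * f s)) 0 := by
  have hS : Summable fun p : S × S => x p.1 * (q p.1 p.2 * f p.2) := by
    refine Summable.of_norm_bounded ((summable_prod_mul_rate hq hr hM hx).mul_right B) fun p => ?_
    rw [Real.norm_eq_abs, abs_mul, abs_mul, abs_of_nonneg (hq _ _), ← mul_assoc]
    exact mul_le_mul_of_nonneg_left (hf _) (mul_nonneg (abs_nonneg _) (hq _ _))
  have h1 : HasSum (fun s => x s * g s) (∑' p : S × S, x p.1 * (q p.1 p.2 * f p.2)) :=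
    hS.hasSum.prod_fiberwise fun s => (hg s).mul_left _
  have h2 : HasSum (fun s => x s * r s * f s) (∑' p : S × S, x p.1 * (q p.1 p.2 * f p.2)) :=
    ((Equiv.prodComm S S).hasSum_iff.2 hS.hasSum).prod_fiberwise fun s => by
      simpa [mul_assoc] using (hb s).mul_right (f s)
  simpa [mul_sub, mul_assoc] using h1.sub h2

end Chain

/-! ### Service rates and transitions under Join-the-Fastest-Free-Chain -/

section Fill

variable {ι : Type*} [LinearOrder ι]

/-- Filling the slots in increasing order with `n` jobs places `min n C` of them. -/
theorem sum_min_sub_sum_lt (c : ι → ℕ) (n : ℕ) (s : Finset ι) :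
    ∑ l ∈ s, min (c l) (n - ∑ l' ∈ s with l' < l, c l') = min n (∑ l ∈ s, c l) := by
  induction s using Finset.induction_on_max with
  | empty => simp
  | insert a s ha ih =>
    have has : a ∉ s := fun h => lt_irrefl _ (ha a h)
    have h1 : (insert a s).filter (· < a) = s := by
      rw [Finset.filter_insert, if_neg (lt_irrefl a), Finset.filter_true_of_mem ha]
    have h2 : ∀ l ∈ s, (insert a s).filter (· < l) = s.filter (· < l) := fun l hl => by
      rw [Finset.filter_insert, if_neg (ha l hl).not_gt]
    have h3 : ∑ l ∈ s, min (c l) (n - ∑ l' ∈ insert a s with l' < l, c l')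
        = min n (∑ l ∈ s, c l) := ih ▸ Finset.sum_congr rfl fun l hl => by rw [h2 l hl]
    rw [Finset.sum_insert has, Finset.sum_insert has, h1, h3]
    omega

variable [Fintype ι] [LocallyFiniteOrderBot ι]

theorem sum_min_sub_sum_Iio (c : ι → ℕ) (n : ℕ) :
    ∑ l, min (c l) (n - ∑ l' ∈ Finset.Iio l, c l') = min n (∑ l, c l) := by
  rw [← sum_min_sub_sum_lt c n Finset.univ]
  refine Finset.sum_congr rfl fun l _ => ?_
  congr 3
  ext
  simp

/-- Among all placements of `n` jobs, filling the slots in increasing order maximizes the sum of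
antitone weights. -/
theorem sum_mul_le_sum_mul_min {w : ι → ℝ} (hw : Antitone w) {c j : ι → ℕ} (hj : ∀ l, j l ≤ c l)
    {n : ℕ} (hn : ∑ l, j l = n) :
    ∑ l, (j l : ℝ) * w l ≤ ∑ l, w l * (min (c l) (n - ∑ l' ∈ Finset.Iio l, c l') : ℕ) := by
  set g : ι → ℕ := fun l => min (c l) (n - ∑ l' ∈ Finset.Iio l, c l') with hg
  have hsum : ∑ l, j l = ∑ l, g l := by
    rw [hg, sum_min_sub_sum_Iio, hn, min_eq_left]
    exact hn ▸ Finset.sum_le_sum fun l _ => hj l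
  -- The first slot that is not filled completely: `g` is `c` before and `0` after it.
  by_cases hex : (Finset.univ.filter fun l => g l < c l).Nonempty
  · obtain ⟨k, hk⟩ : ∃ k, k = (Finset.univ.filter fun l => g l < c l).min' hex := ⟨_, rfl⟩
    have hk1 : g k < c k := by
      simpa [← hk] using Finset.min'_mem _ hex
    have hk2 : ∀ l, l < k → g l = c l := fun l hl => by
      by_contra hne
      have : l ∈ Finset.univ.filter fun l => g l < c l :=
        Finset.mem_filter.2 ⟨Finset.mem_univ _, lt_of_le_of_ne (min_le_left _ _) hne⟩
      exact absurd (hk ▸ Finset.min'_le _ l this) (not_le.2 hl)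
    have hk3 : ∀ l, k < l → g l = 0 := fun l hl => by
      have h1 : c k + ∑ l' ∈ Finset.Iio k, c l' ≤ ∑ l' ∈ Finset.Iio l, c l' := by
        rw [← Finset.sum_insert (by simp)]
        refine Finset.sum_le_sum_of_subset fun a ha => ?_
        rw [Finset.mem_insert, Finset.mem_Iio] at ha
        rw [Finset.mem_Iio]
        rcases ha with rfl | ha
        exacts [hl, ha.trans hl]
      simp only [hg] at hk1 ⊢
      omega
    have h2 : ∀ l, 0 ≤ ((g l : ℝ) - j l) * (w l - w k) := fun l => by
      rcases lt_trichotomy l k with h | h | h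
      · rw [hk2 l h]
        exact mul_nonneg (sub_nonneg.2 (by exact_mod_cast hj l)) (sub_nonneg.2 (hw h.le))
      · simp [h]
      · rw [hk3 l h]
        exact mul_nonneg_of_nonpos_of_nonpos (by simp) (sub_nonpos.2 (hw h.le))
    have h3 := Finset.sum_nonneg fun l (_ : l ∈ Finset.univ) => h2 l
    have h4 : ∑ l, ((g l : ℝ) - j l) * (w l - w k)
        = ∑ l, w l * (g l : ℝ) - ∑ l, (j l : ℝ) * w l
          - (((∑ l, g l : ℕ) : ℝ) - ((∑ l, j l : ℕ) : ℝ)) * w k := by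
      push_cast
      rw [← Finset.sum_sub_distrib, ← Finset.sum_sub_distrib, Finset.sum_mul,
        ← Finset.sum_sub_distrib]
      exact Finset.sum_congr rfl fun l _ => by ring
    rw [h4, hsum, sub_self, zero_mul, sub_zero] at h3
    linarith
  · have hgc : ∀ l, g l = c l := fun l => by
      by_contra hne
      exact hex ⟨l, Finset.mem_filter.2 ⟨Finset.mem_univ _, lt_of_le_of_ne (min_le_left _ _) hne⟩⟩
    have hjg : ∀ l, j l = g l := fun l =>
      (Finset.sum_eq_sum_iff_of_le fun l _ => (hj l).trans (hgc l).ge).1 hsum l (Finset.mem_univ l)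
    exact (Finset.sum_congr rfl fun l _ => by rw [hjg l, mul_comm]).le

end Fill

namespace JFFC

variable {K : ℕ} {μ : Fin K → ℝ} {c : Fin K → ℕ} {lam : ℝ}

/-- Filling the slowest chains first is filling in increasing order for the reversed order, so that
the results on `fastDeathRate` carry over to `slowDeathRate`. -/
theorem slowDeathRate_eq_dual (μ : Fin K → ℝ) (c : Fin K → ℕ) (n : ℕ) :
    slowDeathRate μ c n = ∑ l : (Fin K)ᵒᵈ, μ (OrderDual.ofDual l) *
      (min (c (OrderDual.ofDual l))
        (n - ∑ l' ∈ Finset.Iio l, c (OrderDual.ofDual l')) : ℕ) := by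
  rw [slowDeathRate, ← OrderDual.ofDual.sum_comp]
  refine Finset.sum_congr rfl fun l _ => ?_
  congr 4

theorem sum_mul_le_fastDeathRate (hμ : Antitone μ) {j : Fin K → ℕ} (hj : ∀ l, j l ≤ c l) :
    ∑ l, (j l : ℝ) * μ l ≤ fastDeathRate μ c (∑ l, j l) :=
  sum_mul_le_sum_mul_min hμ hj rfl

theorem slowDeathRate_le_sum_mul (hμ : Antitone μ) {j : Fin K → ℕ} (hj : ∀ l, j l ≤ c l) :
    slowDeathRate μ c (∑ l, j l) ≤ ∑ l, (j l : ℝ) * μ l := by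
  have h := sum_mul_le_sum_mul_min (ι := (Fin K)ᵒᵈ) (w := fun l => - μ (OrderDual.ofDual l))
    (c := fun l => c (OrderDual.ofDual l)) (j := fun l => j (OrderDual.ofDual l))
    (fun a b hab => neg_le_neg (hμ hab)) (fun l => hj _) (n := ∑ l, j l)
    (OrderDual.ofDual.sum_comp j)
  rw [slowDeathRate_eq_dual]
  simp only [mul_neg, neg_mul, Finset.sum_neg_distrib] at h
  refine (neg_le_neg_iff.1 h).trans_eq ?_
  exact OrderDual.ofDual.sum_comp fun l => (j l : ℝ) * μ l

section DeathRate

variable {ι : Type*} [Fintype ι] {w : ι → ℝ} {g b : ι → ℕ}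

theorem sum_mul_pos_of_sum_pos (hw : ∀ l, 0 < w l) (hg : 1 ≤ ∑ l, g l) :
    0 < ∑ l, w l * (g l : ℝ) := by
  obtain ⟨l, -, hl⟩ := Finset.exists_ne_zero_of_sum_ne_zero (by omega : ∑ l, g l ≠ 0)
  exact Finset.sum_pos' (fun l _ => mul_nonneg (hw l).le (Nat.cast_nonneg _))
    ⟨l, Finset.mem_univ l, mul_pos (hw l) (by exact_mod_cast Nat.pos_of_ne_zero hl)⟩

theorem sum_mul_eq_of_sum_eq (hgb : ∀ l, g l ≤ b l) (h : ∑ l, g l = ∑ l, b l) :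
    ∑ l, w l * (g l : ℝ) = ∑ l, (b l : ℝ) * w l := by
  have := (Finset.sum_eq_sum_iff_of_le fun l _ => hgb l).1 h
  exact Finset.sum_congr rfl fun l hl => by rw [this l hl, mul_comm]

end DeathRate

theorem fastDeathRate_pos (hμ : ∀ l, 0 < μ l) (hC : 1 ≤ totalCapacity c) {n : ℕ} (hn : 1 ≤ n) :
    0 < fastDeathRate μ c n :=
  sum_mul_pos_of_sum_pos hμ (by rw [sum_min_sub_sum_Iio]; exact le_min hn hC)

theorem fastDeathRate_of_le {n : ℕ} (hn : totalCapacity c ≤ n) :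
    fastDeathRate μ c n = totalRate μ c :=
  sum_mul_eq_of_sum_eq (fun l => min_le_left _ _)
    (by rw [sum_min_sub_sum_Iio]; exact min_eq_right hn)

theorem slowDeathRate_pos (hμ : ∀ l, 0 < μ l) (hC : 1 ≤ totalCapacity c) {n : ℕ} (hn : 1 ≤ n) :
    0 < slowDeathRate μ c n := by
  rw [slowDeathRate_eq_dual]
  refine sum_mul_pos_of_sum_pos (fun l => hμ _) ?_
  rw [sum_min_sub_sum_Iio (fun l : (Fin K)ᵒᵈ => c (OrderDual.ofDual l))]
  exact le_min hn (hC.trans_eq (OrderDual.ofDual.sum_comp c).symm)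

theorem slowDeathRate_of_le {n : ℕ} (hn : totalCapacity c ≤ n) :
    slowDeathRate μ c n = totalRate μ c := by
  rw [slowDeathRate_eq_dual]
  refine (sum_mul_eq_of_sum_eq (fun l => min_le_left _ _) ?_).trans
    (OrderDual.ofDual.sum_comp fun l => (c l : ℝ) * μ l)
  rw [sum_min_sub_sum_Iio (fun l : (Fin K)ᵒᵈ => c (OrderDual.ofDual l))]
  exact min_eq_right ((OrderDual.ofDual.sum_comp c).trans_le hn)

theorem one_le_totalCapacity (hlam : 0 < lam) (hstable : lam < totalRate μ c) :
    1 ≤ totalCapacity c := by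
  by_contra h
  have h0 : ∀ l, c l = 0 := by
    simpa [totalCapacity] using h
  simp [totalRate, h0] at hstable
  linarith

namespace State

theorem total_arrive (z : State c) : z.arrive.total = z.total + 1 := by
  unfold arrive total
  split_ifs with h
  · simp only
    rw [Finset.sum_update_of_mem (Finset.mem_univ _), add_right_comm, add_assoc, add_assoc,
      ← Finset.add_sum_erase _ _ (Finset.mem_univ (z.fastestFree h)),
      Finset.sdiff_singleton_eq_erase]
    omega
  · simp only
    omega

theorem total_complete (z : State c) {l : Fin K} (hl : z.jobs l ≠ 0) :
    (z.complete l).total + 1 = z.total := by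
  unfold complete total
  split_ifs with h
  · simp only
    rw [Finset.sum_update_of_mem (Finset.mem_univ _),
      ← Finset.add_sum_erase _ z.jobs (Finset.mem_univ l), Finset.sdiff_singleton_eq_erase]
    omega
  · simp only
    omega

/-- The state with all chains fully occupied and `n` jobs in the queue. -/
def full (c : Fin K → ℕ) (n : ℕ) : State c := ⟨n, c, fun _ => le_rfl, fun _ => rfl⟩

theorem eq_full {z : State c} (h : ¬ z.HasFree) : z = full c z.queue :=
  State.ext rfl (z.jobs_eq h)

theorem not_hasFree_full (n : ℕ) : ¬ (full c n).HasFree := fun ⟨_, hl⟩ => lt_irrefl _ hl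

theorem eq_full_of_queue_ne_zero {z : State c} (h : z.queue ≠ 0) : z = full c z.queue :=
  State.ext rfl (z.full_of_queue h)

theorem full_injective : Function.Injective (full c) := fun _ _ h => congrArg State.queue h

theorem arrive_full (n : ℕ) : (full c n).arrive = full c (n + 1) := by
  rw [arrive, dif_neg (not_hasFree_full n)]
  rfl

theorem complete_full (n : ℕ) (l : Fin K) : (full c (n + 1)).complete l = full c n := by
  rw [complete, dif_neg (show (full c (n + 1)).queue ≠ 0 from Nat.succ_ne_zero n)]
  rfl

theorem queue_arrive_of_hasFree {z : State c} (h : z.HasFree) : z.arrive.queue = 0 := by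
  rw [arrive, dif_pos h]
  exact z.queue_eq_zero h

theorem queue_complete (z : State c) (l : Fin K) : (z.complete l).queue = z.queue - 1 := by
  unfold complete
  split_ifs with h
  · simp [h]
  · rfl

theorem jobs_arrive {z : State c} (h : z.HasFree) :
    z.arrive.jobs = Function.update z.jobs (z.fastestFree h) (z.jobs (z.fastestFree h) + 1) := by
  rw [arrive, dif_pos h]

theorem jobs_complete {z : State c} (h : z.queue = 0) (l : Fin K) :
    (z.complete l).jobs = Function.update z.jobs l (z.jobs l - 1) := by
  rw [complete, dif_pos h]

/-- Total rate of completions in state `z`. -/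
def serviceRate (μ : Fin K → ℝ) (z : State c) : ℝ := ∑ l, (z.jobs l : ℝ) * μ l

theorem serviceRate_full (n : ℕ) : (full c n).serviceRate μ = totalRate μ c := rfl

theorem serviceRate_le (hμ : ∀ l, 0 < μ l) (z : State c) : z.serviceRate μ ≤ totalRate μ c :=
  Finset.sum_le_sum fun l _ =>
    mul_le_mul_of_nonneg_right (by exact_mod_cast z.jobs_le l) (hμ l).le

theorem serviceRate_le_fastDeathRate (hμ : Antitone μ) (z : State c) :
    z.serviceRate μ ≤ fastDeathRate μ c z.total := by
  by_cases h : z.HasFree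
  · rw [total, z.queue_eq_zero h, zero_add]
    exact sum_mul_le_fastDeathRate hμ z.jobs_le
  · rw [eq_full h, serviceRate_full, fastDeathRate_of_le]
    exact Nat.le_add_left _ _

theorem slowDeathRate_le_serviceRate (hμ : Antitone μ) (z : State c) :
    slowDeathRate μ c z.total ≤ z.serviceRate μ := by
  by_cases h : z.HasFree
  · rw [total, z.queue_eq_zero h, zero_add]
    exact slowDeathRate_le_sum_mul hμ z.jobs_le
  · rw [eq_full h, serviceRate_full, slowDeathRate_of_le]
    exact Nat.le_add_left _ _

end State

open State

theorem rate_nonneg (hμ : ∀ l, 0 < μ l) (hlam : 0 < lam) (z z' : State c) :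
    0 ≤ rate lam μ c z z' := by
  refine add_nonneg (by split_ifs <;> simp [hlam.le]) (Finset.sum_nonneg fun l _ => ?_)
  split_ifs
  · exact mul_nonneg (Nat.cast_nonneg _) (hμ l).le
  · exact le_rfl

theorem hasSum_rate_mul (z : State c) (f : State c → ℝ) :
    HasSum (fun z' => rate lam μ c z z' * f z')
      (lam * f z.arrive + ∑ l, (z.jobs l : ℝ) * μ l * f (z.complete l)) := by
  have h1 : ∀ (w : State c) (a : ℝ) (_ : ∀ z', Decidable (z' = w)),
      HasSum (fun z' => if z' = w then a * f z' else 0) (a * f w) := fun w a _ => by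
    convert hasSum_single (f := fun z' => if z' = w then a * f z' else 0) w ?_ using 1
    · rw [if_pos rfl]
    · exact fun z' hz' => if_neg hz'
  simp only [rate, add_mul, Finset.sum_mul, ite_mul, zero_mul]
  exact (h1 _ _ _).add (hasSum_sum fun l _ => h1 _ _ _)

theorem hasSum_rate (z : State c) : HasSum (rate lam μ c z) (lam + z.serviceRate μ) := by
  simpa [serviceRate] using hasSum_rate_mul (lam := lam) (μ := μ) z 1

theorem rate_arrive_pos (hμ : ∀ l, 0 < μ l) (hlam : 0 < lam) (z : State c) :
    0 < rate lam μ c z z.arrive := by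
  refine add_pos_of_pos_of_nonneg (by simpa using hlam) (Finset.sum_nonneg fun l _ => ?_)
  split_ifs
  · exact mul_nonneg (Nat.cast_nonneg _) (hμ l).le
  · exact le_rfl

theorem rate_complete_pos (hμ : ∀ l, 0 < μ l) (hlam : 0 < lam) (z : State c) {l : Fin K}
    (hl : z.jobs l ≠ 0) : 0 < rate lam μ c z (z.complete l) := by
  refine add_pos_of_nonneg_of_pos (by split_ifs <;> simp [hlam.le]) ?_
  refine Finset.sum_pos' (fun k _ => ?_) ⟨l, Finset.mem_univ l, ?_⟩
  · split_ifs
    · exact mul_nonneg (Nat.cast_nonneg _) (hμ k).le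
    · exact le_rfl
  · rw [if_pos rfl]
    exact mul_pos (by exact_mod_cast Nat.pos_of_ne_zero hl) (hμ l)

/-- The state `full c 0` is reached from every state: by completions if the queue is non-empty, and
by arrivals otherwise. -/
theorem reachable_full (hμ : ∀ l, 0 < μ l) (hlam : 0 < lam) (hC : 1 ≤ totalCapacity c)
    (z : State c) :
    Relation.ReflTransGen (fun a b => 0 < rate lam μ c a b) z (full c 0) := by
  have hfull : ∀ n, Relation.ReflTransGen (fun a b => 0 < rate lam μ c a b)
      (full c n) (full c 0) := by
    intro n
    induction n with
    | zero => exact .refl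
    | succ n ih =>
      obtain ⟨l, -, hl⟩ := Finset.exists_ne_zero_of_sum_ne_zero
        (by unfold totalCapacity at hC; omega : ∑ l, c l ≠ 0)
      refine .head ?_ ih
      rw [← complete_full n l]
      exact rate_complete_pos hμ hlam _ hl
  obtain ⟨k, hk⟩ : ∃ k, k = totalCapacity c - z.total := ⟨_, rfl⟩
  induction k generalizing z with
  | zero =>
    by_cases h : z.HasFree
    · obtain ⟨l, hl⟩ := h
      have h1 := Finset.sum_lt_sum (fun l _ => z.jobs_le l) ⟨l, Finset.mem_univ l, hl⟩
      rw [total, z.queue_eq_zero ⟨l, hl⟩, totalCapacity] at hk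
      omega
    · rw [eq_full h]
      exact hfull _
  | succ k ih =>
    refine .head (rate_arrive_pos hμ hlam z) (ih _ ?_)
    rw [total_arrive]
    omega

end JFFC

/-! ### Existence and uniqueness of the steady state -/

namespace JFFC

open State

variable {K : ℕ} {μ : Fin K → ℝ} {c : Fin K → ℕ} {lam : ℝ}

instance : Finite {z : State c // z.queue = 0} := by
  refine Finite.of_injective
    (fun z (l : Fin K) => (⟨z.1.jobs l, Nat.lt_succ_of_le (z.1.jobs_le l)⟩ : Fin (c l + 1))) ?_
  intro z z' h
  refine Subtype.ext (State.ext (z.2.trans z'.2.symm) (funext fun l => ?_))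
  simpa using congrFun h l

/-- The state space consists of the states without queue and of the states `full c (n + 1)`. -/
theorem hasSum_of_queue_zero_of_full {f : State c → ℝ} {a b : ℝ}
    (ha : HasSum (fun z : {z : State c // z.queue = 0} => f z) a)
    (hb : HasSum (fun n => f (full c (n + 1))) b) : HasSum f (a + b) := by
  have hinj : Function.Injective fun n => full c (n + 1) := fun m n h =>
    Nat.succ_injective (full_injective h)
  refine HasSum.add_isCompl (s := {z | z.queue = 0}) (t := Set.range fun n => full c (n + 1))
    ?_ ha (hinj.hasSum_range_iff.2 hb)
  refine IsCompl.of_eq ?_ ?_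
  · ext z
    simp only [Set.inf_eq_inter, Set.mem_inter_iff, Set.mem_ofPred_eq, Set.mem_range,
      Set.bot_eq_empty, Set.mem_empty_iff_false, iff_false, not_and, not_exists]
    rintro h n rfl
    exact Nat.succ_ne_zero n h
  · ext z
    simp only [Set.sup_eq_union, Set.mem_union, Set.mem_ofPred_eq, Set.mem_range, Set.top_eq_univ,
      Set.mem_univ, iff_true]
    by_cases h : z.queue = 0
    · exact .inl h
    · refine .inr ⟨z.queue - 1, ?_⟩
      rw [Nat.sub_add_cancel (Nat.one_le_iff_ne_zero.2 h), ← eq_full_of_queue_ne_zero h]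

theorem rate_eq_zero {z z' : State c} (h1 : z' ≠ z.arrive) (h2 : ∀ l, z' ≠ z.complete l) :
    rate lam μ c z z' = 0 := by
  simp [rate, h1, h2]

theorem rate_full_succ (n : ℕ) : rate lam μ c (full c n) (full c (n + 1)) = lam := by
  have h : ∀ l, full c (n + 1) ≠ (full c n).complete l := fun l hl => by
    have := congrArg State.queue hl
    rw [queue_complete] at this
    simp only [full] at this
    omega
  simp [rate, arrive_full, h]

theorem rate_succ_full (n : ℕ) :
    rate lam μ c (full c (n + 1)) (full c n) = totalRate μ c := by
  have h : full c n ≠ full c (n + 2) := fun h => by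
    have := full_injective h
    omega
  rw [← arrive_full (n + 1)] at h
  simp only [rate, if_neg h, complete_full, if_true, zero_add, totalRate]
  rfl

/-- The full states are entered only from their neighbours in the queue or from the states without a
queue. -/
theorem rate_to_full_succ_eq_zero {z : State c} {n : ℕ} (h1 : z ≠ full c n)
    (h2 : z ≠ full c (n + 2)) : rate lam μ c z (full c (n + 1)) = 0 := by
  refine rate_eq_zero (fun h => ?_) fun l h => ?_
  · by_cases hz : z.HasFree
    · have := congrArg State.queue h
      rw [queue_arrive_of_hasFree hz] at this
      exact Nat.succ_ne_zero n this
    · rw [eq_full hz, arrive_full] at h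
      have := full_injective h
      exact h1 (by rw [eq_full hz]; congr 1; omega)
  · have hq := congrArg State.queue h
    rw [queue_complete] at hq
    simp only [full] at hq
    exact h2 (by rw [eq_full_of_queue_ne_zero (z := z) (by omega)]; congr 1; omega)

theorem rate_full_to_queue_zero {z : State c} {n : ℕ} (hz : z.queue = 0)
    (h : n ≠ 0 ∨ z ≠ full c 0) :
    rate lam μ c (full c (n + 1)) z = 0 := by
  refine rate_eq_zero (fun h' => ?_) fun l h' => ?_
  · rw [h', arrive_full] at hz
    exact Nat.succ_ne_zero _ hz
  · rw [complete_full] at h'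
    subst h'
    have hn : n = 0 := hz
    subst hn
    simp at h

/-- A stationary distribution of the finite chain without queue extends to the whole state space by
geometric decay in the length of the queue. -/
theorem exists_isStationaryDistribution (hμ : ∀ l, 0 < μ l) (hlam : 0 < lam)
    (hstable : lam < totalRate μ c) : ∃ π, IsStationaryDistribution (rate lam μ c) π := by
  classical
  have := Fintype.ofFinite {z : State c // z.queue = 0}
  have : Nonempty {z : State c // z.queue = 0} := ⟨⟨full c 0, rfl⟩⟩
  set ν := totalRate μ c with hνdef
  have hν : 0 < ν := hlam.trans hstable
  have hρ0 : 0 ≤ lam / ν := by positivity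
  have hρ : lam / ν < 1 := (div_lt_one hν).2 hstable
  obtain ⟨p, hp0, hp1, hp⟩ := exists_isStationaryDistribution_of_fintype
    (q := fun a b : {z : State c // z.queue = 0} => rate lam μ c a b)
    (fun a b => rate_nonneg hμ hlam a.1 b.1)
  let base : State c → {z : State c // z.queue = 0} := fun z =>
    ⟨⟨0, z.jobs, z.jobs_le, fun h => absurd rfl h⟩, rfl⟩
  have hbase : ∀ z : {z : State c // z.queue = 0}, base z = z := fun z =>
    Subtype.ext (State.ext z.2.symm rfl)
  let π : State c → ℝ := fun z => p (base z) * (lam / ν) ^ z.queue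
  have hπF : ∀ z : {z : State c // z.queue = 0}, π z = p z := fun z => by
    simp only [π, hbase, z.2, pow_zero, mul_one]
  have hπ0 : ∀ z, 0 ≤ π z := fun z => mul_nonneg (hp0 _) (pow_nonneg hρ0 _)
  have hπfull : ∀ n, π (full c (n + 1)) * ν = π (full c n) * lam := fun n => by
    have : base (full c (n + 1)) = base (full c n) := rfl
    simp only [π, this, show (full c (n + 1)).queue = n + 1 from rfl,
      show (full c n).queue = n from rfl, pow_succ]
    field_simp
  have hsum : HasSum π (1 + p (base (full c 0)) * (lam / ν) * (1 - lam / ν)⁻¹) := by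
    refine hasSum_of_queue_zero_of_full (by simpa only [hπF] using hp1) ?_
    refine ((hasSum_geometric_of_lt_one hρ0 hρ).mul_left _).congr_fun fun n => ?_
    simp only [π, show base (full c (n + 1)) = base (full c 0) from rfl,
      show (full c (n + 1)).queue = n + 1 from rfl, pow_succ]
    ring
  have hT : 0 < 1 + p (base (full c 0)) * (lam / ν) * (1 - lam / ν)⁻¹ := by
    have := mul_nonneg (mul_nonneg (hp0 (base (full c 0))) hρ0) (inv_nonneg.2 (sub_pos.2 hρ).le)
    linarith
  have hb : IsBalanced (rate lam μ c) (fun z => lam + z.serviceRate μ) π := by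
    intro s
    beta_reduce
    rcases Nat.eq_zero_or_pos s.queue with hs | hs
    · -- For a state without queue, the only flow to and from states with a queue is between
      -- `full c 0` and `full c 1`, and it is balanced by itself.
      obtain ⟨r, hr1, hr2⟩ := hp ⟨s, hs⟩
      have hin : HasSum (fun z' => π z' * rate lam μ c z' s)
          (p ⟨s, hs⟩ * r + π (full c 1) * rate lam μ c (full c 1) s) := by
        refine hasSum_of_queue_zero_of_full (by simpa only [hπF] using hr2) ?_
        exact hasSum_single 0 fun n hn => by rw [rate_full_to_queue_zero hs (.inl hn), mul_zero]
      have hout : HasSum (rate lam μ c s) (r + rate lam μ c s (full c 1)) := by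
        refine hasSum_of_queue_zero_of_full hr1 (hasSum_single 0 fun n hn => ?_)
        refine rate_to_full_succ_eq_zero (fun h => ?_) fun h => ?_ <;> rw [h] at hs
        · exact hn hs
        · exact Nat.succ_ne_zero _ hs
      have hflow : π (full c 1) * rate lam μ c (full c 1) s
          = π s * rate lam μ c s (full c 1) := by
        by_cases h : s = full c 0
        · rw [h, rate_full_succ, rate_succ_full, hπfull]
        · rw [rate_full_to_queue_zero hs (.inr h), rate_to_full_succ_eq_zero h, mul_zero, mul_zero]
          rintro rfl
          exact absurd hs (Nat.succ_ne_zero _)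
      rw [(hasSum_rate s).unique hout, mul_add, ← hflow, hπF ⟨s, hs⟩]
      exact hin
    · obtain ⟨n, hn⟩ : ∃ n, s = full c (n + 1) :=
        ⟨s.queue - 1, by rw [Nat.sub_add_cancel hs, ← eq_full_of_queue_ne_zero hs.ne']⟩
      subst hn
      refine hasSum_of_sum_eq {full c n, full c (n + 2)} (fun z hz => ?_) ?_
      · simp only [Finset.mem_insert, Finset.mem_singleton, not_or] at hz
        rw [rate_to_full_succ_eq_zero hz.1 hz.2, mul_zero]
      · rw [Finset.sum_pair fun h => by have := full_injective h; omega, rate_full_succ,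
          rate_succ_full, serviceRate_full, ← hνdef, hπfull (n + 1), ← hπfull n]
        ring
  refine ⟨_, (hb.smul (1 + p (base (full c 0)) * (lam / ν) * (1 - lam / ν)⁻¹)⁻¹)
    |>.isStationaryDistribution hasSum_rate
    (fun z => mul_nonneg (inv_nonneg.2 hT.le) (hπ0 z)) ?_⟩
  have := hsum.mul_left (1 + p (base (full c 0)) * (lam / ν) * (1 - lam / ν)⁻¹)⁻¹
  rwa [inv_mul_cancel₀ hT.ne'] at this

theorem existsUnique_isStationaryDistribution (hμ : ∀ l, 0 < μ l) (hlam : 0 < lam)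
    (hstable : lam < totalRate μ c) : ∃! π, IsStationaryDistribution (rate lam μ c) π := by
  obtain ⟨π, hπ⟩ := exists_isStationaryDistribution hμ hlam hstable
  exact ⟨π, hπ, fun π' hπ' => hπ'.unique (rate_nonneg hμ hlam) hasSum_rate
    (fun z => by grw [serviceRate_le hμ z]) (full c 0)
    (reachable_full hμ hlam (one_le_totalCapacity hlam hstable)) hπ⟩

end JFFC

/-! ### Bounds on the mean number of jobs -/

namespace JFFC

open State

variable {K : ℕ} {μ : Fin K → ℝ} {c : Fin K → ℕ} {lam : ℝ} {π : State c → ℝ}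

theorem State.total_eq_add_iff {z : State c} {k : ℕ} :
    z.total = k + totalCapacity c ↔ z = full c k := by
  constructor
  · intro h
    by_cases hz : z.HasFree
    · obtain ⟨l, hl⟩ := hz
      have h1 := Finset.sum_lt_sum (fun l _ => z.jobs_le l) ⟨l, Finset.mem_univ l, hl⟩
      rw [total, z.queue_eq_zero ⟨l, hl⟩, totalCapacity] at h
      omega
    · rw [eq_full hz] at h ⊢
      congr 1
      exact Nat.add_right_cancel h
  · rintro rfl
    rfl

theorem hasSum_drift (hμ : ∀ l, 0 < μ l) (hlam : 0 < lam)
    (hπ : IsStationaryDistribution (rate lam μ c) π) {f : State c → ℝ} {B : ℝ}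
    (hf : ∀ z, |f z| ≤ B) :
    HasSum (fun z => π z * (lam * (f z.arrive - f z)
      + ∑ l, (z.jobs l : ℝ) * μ l * (f (z.complete l) - f z))) 0 := by
  have h := (hπ.isBalanced hasSum_rate).hasSum_drift (rate_nonneg hμ hlam) hasSum_rate
    (fun z => by grw [serviceRate_le hμ z]) hπ.2.1.summable hf
    (fun z => hasSum_rate_mul z f)
  refine h.congr_fun fun z => ?_
  simp only [serviceRate, add_mul, Finset.sum_mul, mul_sub, Finset.sum_sub_distrib]
  ring

/-- The stationary distribution of the total number of jobs in the system. -/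
noncomputable def totalProb (π : State c → ℝ) (n : ℕ) : ℝ := ∑' z : State.total ⁻¹' {n}, π z.1

theorem hasSum_totalProb (hπ : HasSum π 1) : HasSum (totalProb π) 1 :=
  hπ.tsum_fiberwise State.total

theorem totalProb_add (k : ℕ) : totalProb π (k + totalCapacity c) = π (full c k) := by
  have : (State.total ⁻¹' {k + totalCapacity c} : Set (State c)) = {full c k} := by
    ext z
    exact total_eq_add_iff
  rw [totalProb, this, tsum_singleton]

theorem totalProb_nonneg (hπ : ∀ z, 0 ≤ π z) (n : ℕ) : 0 ≤ totalProb π n :=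
  tsum_nonneg fun z => hπ z

theorem summable_mul_serviceRate (hμ : ∀ l, 0 < μ l) (h0 : ∀ z, 0 ≤ π z) (h1 : Summable π) :
    Summable fun z => π z * z.serviceRate μ :=
  (h1.mul_right (totalRate μ c)).of_nonneg_of_le
    (fun z => mul_nonneg (h0 z) (Finset.sum_nonneg fun l _ =>
      mul_nonneg (Nat.cast_nonneg _) (hμ l).le))
    fun z => mul_le_mul_of_nonneg_left (serviceRate_le hμ z) (h0 z)

/-- The stationary flow from the states with `n` jobs to those with `n + 1` jobs equals the flow
back: this is the vanishing mean drift of the indicator of `{z | z.total ≤ n}`. -/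
theorem totalProb_mul_eq (hμ : ∀ l, 0 < μ l) (hlam : 0 < lam)
    (hπ : IsStationaryDistribution (rate lam μ c) π) (n : ℕ) :
    totalProb π n * lam = ∑' z : State.total ⁻¹' {n + 1}, π z.1 * z.1.serviceRate μ := by
  classical
  have h := hasSum_drift hμ hlam hπ (f := fun z => if z.total ≤ n then 1 else 0) (B := 1)
    (fun z => by split_ifs <;> simp)
  have h1 : HasSum (fun z => (State.total ⁻¹' {n}).indicator π z * lam) (totalProb π n * lam) := by
    rw [totalProb, tsum_subtype]
    exact ((hπ.2.1.summable.indicator _).hasSum).mul_right lam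
  have h2 : HasSum ((State.total ⁻¹' {n + 1}).indicator fun z => π z * z.serviceRate μ)
      (∑' z : State.total ⁻¹' {n + 1}, π z.1 * z.1.serviceRate μ) := by
    rw [tsum_subtype (State.total ⁻¹' {n + 1}) fun z => π z * z.serviceRate μ]
    exact ((summable_mul_serviceRate hμ hπ.1 hπ.2.1.summable).indicator _).hasSum
  have h3 := (h2.sub h1).unique (h.congr_fun fun z => ?_)
  · linarith
  have hcompl : ∑ l, (z.jobs l : ℝ) * μ l *
      ((if (z.complete l).total ≤ n then 1 else 0) - if z.total ≤ n then 1 else 0)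
      = if z.total = n + 1 then z.serviceRate μ else 0 := by
    have h4 : ∀ l, (z.jobs l : ℝ) * μ l *
        ((if (z.complete l).total ≤ n then 1 else 0) - if z.total ≤ n then 1 else 0)
        = if z.total = n + 1 then (z.jobs l : ℝ) * μ l else 0 := fun l => by
      by_cases hl : z.jobs l = 0
      · simp [hl]
      · have h5 := total_complete z hl
        by_cases h6 : z.total = n + 1
        · simp [h6, show (z.complete l).total ≤ n by omega]
        · by_cases h7 : z.total ≤ n
          · simp [h6, h7, show (z.complete l).total ≤ n by omega]
          · simp [h6, h7, show ¬ (z.complete l).total ≤ n by omega]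
    rw [Finset.sum_congr rfl fun l _ => h4 l]
    split_ifs
    · rfl
    · simp
  rw [hcompl, total_arrive]
  simp only [Set.indicator_apply, Set.mem_preimage, Set.mem_singleton_iff]
  rcases lt_trichotomy z.total n with h | h | h
  · simp [h.ne, h.le, show z.total + 1 ≤ n by omega, show z.total ≠ n + 1 by omega]
  · simp [h]
  · by_cases h' : z.total = n + 1
    · simp [h']
    · simp [h', h.ne', show ¬ z.total ≤ n by omega, show ¬ z.total + 1 ≤ n by omega]

theorem mul_full_succ (hμ : ∀ l, 0 < μ l) (hlam : 0 < lam)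
    (hπ : IsStationaryDistribution (rate lam μ c) π) (n : ℕ) :
    π (full c n) * lam = π (full c (n + 1)) * totalRate μ c := by
  have h := totalProb_mul_eq hμ hlam hπ (n + totalCapacity c)
  have : (State.total ⁻¹' {n + totalCapacity c + 1} : Set (State c)) = {full c (n + 1)} := by
    ext z
    rw [add_right_comm]
    exact total_eq_add_iff
  rw [totalProb_add, this, tsum_singleton (f := fun z => π z * z.serviceRate μ)] at h
  exact h

theorem totalProb_mul_le (hμ : ∀ l, 0 < μ l) (hsort : Antitone μ) (hlam : 0 < lam)
    (hπ : IsStationaryDistribution (rate lam μ c) π) (n : ℕ) :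
    totalProb π n * lam ≤ totalProb π (n + 1) * fastDeathRate μ c (n + 1) := by
  rw [totalProb_mul_eq hμ hlam hπ, totalProb, ← tsum_mul_right]
  refine Summable.tsum_le_tsum (fun z => mul_le_mul_of_nonneg_left ?_ (hπ.1 z))
    ((summable_mul_serviceRate hμ hπ.1 hπ.2.1.summable).subtype _)
    ((hπ.2.1.summable.subtype _).mul_right _)
  have h := serviceRate_le_fastDeathRate hsort z.1
  rwa [show z.1.total = n + 1 from z.2] at h

theorem totalProb_succ_mul_le (hμ : ∀ l, 0 < μ l) (hsort : Antitone μ) (hlam : 0 < lam)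
    (hπ : IsStationaryDistribution (rate lam μ c) π) (n : ℕ) :
    totalProb π (n + 1) * slowDeathRate μ c (n + 1) ≤ totalProb π n * lam := by
  rw [totalProb_mul_eq hμ hlam hπ, totalProb, ← tsum_mul_right]
  refine Summable.tsum_le_tsum (fun z => mul_le_mul_of_nonneg_left ?_ (hπ.1 z))
    ((hπ.2.1.summable.subtype _).mul_right _)
    ((summable_mul_serviceRate hμ hπ.1 hπ.2.1.summable).subtype _)
  have h := slowDeathRate_le_serviceRate hsort z.1
  rwa [show z.1.total = n + 1 from z.2] at h

theorem totalProb_pos (hμ : ∀ l, 0 < μ l) (hsort : Antitone μ) (hlam : 0 < lam)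
    (hstable : lam < totalRate μ c) (hπ : IsStationaryDistribution (rate lam μ c) π) (n : ℕ) :
    0 < totalProb π n := by
  have hC := one_le_totalCapacity hlam hstable
  have hiff : ∀ n, totalProb π n = 0 ↔ totalProb π 0 = 0 := fun n => by
    induction n with
    | zero => rfl
    | succ n ih =>
      rw [← ih]
      have h1 := totalProb_mul_le hμ hsort hlam hπ n
      have h2 := totalProb_succ_mul_le hμ hsort hlam hπ n
      refine ⟨fun h => ?_, fun h => ?_⟩ <;> rw [h, zero_mul] at h1 h2
      · exact le_antisymm (nonpos_of_mul_nonpos_left h1 hlam) (totalProb_nonneg hπ.1 _)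
      · exact le_antisymm (nonpos_of_mul_nonpos_left h2 (slowDeathRate_pos hμ hC (by omega)))
          (totalProb_nonneg hπ.1 _)
  refine (totalProb_nonneg hπ.1 n).lt_of_ne' fun h => ?_
  have h0 : totalProb π = 0 := funext fun m => (hiff m).2 ((hiff n).1 h)
  have := hasSum_totalProb hπ.2.1
  rw [h0] at this
  exact zero_ne_one (hasSum_zero.unique this)

theorem full_eq_mul_pow (hμ : ∀ l, 0 < μ l) (hlam : 0 < lam) (hstable : lam < totalRate μ c)
    (hπ : IsStationaryDistribution (rate lam μ c) π) (n : ℕ) :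
    π (full c n) = π (full c 0) * (lam / totalRate μ c) ^ n := by
  have hν := hlam.trans hstable
  induction n with
  | zero => simp
  | succ n ih =>
    refine mul_right_cancel₀ hν.ne' ?_
    rw [← mul_full_succ hμ hlam hπ, ih, pow_succ]
    field_simp

theorem summable_mul_totalProb (hμ : ∀ l, 0 < μ l) (hlam : 0 < lam)
    (hstable : lam < totalRate μ c) (hπ : IsStationaryDistribution (rate lam μ c) π) :
    Summable fun n : ℕ => (n : ℝ) * totalProb π n := by
  have hν := hlam.trans hstable
  have hρ0 : 0 ≤ lam / totalRate μ c := by positivity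
  have hρ : lam / totalRate μ c < 1 := (div_lt_one hν).2 hstable
  rw [← summable_nat_add_iff (totalCapacity c)]
  have h1 := hasSum_coe_mul_geometric_of_norm_lt_one (𝕜 := ℝ) (r := lam / totalRate μ c)
    (by rwa [Real.norm_of_nonneg hρ0])
  have h2 := (hasSum_geometric_of_lt_one hρ0 hρ).mul_left (totalCapacity c : ℝ)
  refine ((h1.add h2).mul_left (π (full c 0))).summable.congr fun n => ?_
  rw [totalProb_add, full_eq_mul_pow hμ hlam hstable hπ n]
  push_cast
  ring

theorem summable_total_mul (hμ : ∀ l, 0 < μ l) (hlam : 0 < lam)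
    (hstable : lam < totalRate μ c) (hπ : IsStationaryDistribution (rate lam μ c) π) :
    Summable fun z : State c => (z.total : ℝ) * π z := by
  have hfib : ∀ n, HasSum (fun z : State.total ⁻¹' {n} => (z.1.total : ℝ) * π z.1)
      ((n : ℝ) * totalProb π n) := fun n => by
    refine ((hπ.2.1.summable.subtype _).hasSum.mul_left (n : ℝ)).congr_fun fun z => ?_
    rw [show z.1.total = n from z.2]
    rfl
  rw [← (Equiv.sigmaFiberEquiv (State.total : State c → ℕ)).summable_iff]
  refine (summable_sigma_of_nonneg fun z => mul_nonneg (Nat.cast_nonneg _) (hπ.1 _)).2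
    ⟨fun n => (hfib n).summable, ?_⟩
  exact (summable_mul_totalProb hμ hlam hstable hπ).congr fun n => (hfib n).tsum_eq.symm

theorem hasSum_mul_totalProb (hμ : ∀ l, 0 < μ l) (hlam : 0 < lam)
    (hstable : lam < totalRate μ c) (hπ : IsStationaryDistribution (rate lam μ c) π) :
    HasSum (fun n : ℕ => (n : ℝ) * totalProb π n) (∑' z : State c, (z.total : ℝ) * π z) := by
  refine ((summable_total_mul hμ hlam hstable hπ).hasSum.tsum_fiberwise State.total).congr_fun
    fun n => ?_
  rw [totalProb, ← tsum_mul_left]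
  exact tsum_congr fun z => by rw [show z.1.total = n from z.2]

theorem lowerBound_le (hμ : ∀ l, 0 < μ l) (hsort : Antitone μ) (hlam : 0 < lam)
    (hstable : lam < totalRate μ c) (hπ : IsStationaryDistribution (rate lam μ c) π) :
    lowerBound lam μ c ≤ ∑' z : State c, (z.total : ℝ) * π z := by
  have hC := one_le_totalCapacity hlam hstable
  have hd : ∀ n, totalCapacity c ≤ n → fastDeathRate μ c n = totalRate μ c :=
    fun n => fastDeathRate_of_le
  have hd0 : ∀ n, 1 ≤ n → 0 < fastDeathRate μ c n := fun n => fastDeathRate_pos hμ hC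
  refine mean_le_of_monotone_ratio (totalProb_pos hμ hsort hlam hstable hπ)
    (hasSum_phi hlam hstable hC hd hd0) (hasSum_totalProb hπ.2.1)
    (hasSum_mul_phi hlam hstable hd) (hasSum_mul_totalProb hμ hlam hstable hπ) fun n => ?_
  refine le_of_mul_le_mul_right ?_ hlam
  have h1 := mul_le_mul_of_nonneg_left (totalProb_mul_le hμ hsort hlam hπ n)
    (phi_pos (C := totalCapacity c) hlam hstable hd0 (n + 1)).le
  have h2 := phi_mul_eq (lam := lam) (ν := totalRate μ c) (C := totalCapacity c) hd0 n
  linear_combination h1 - totalProb π (n + 1) * h2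

theorem le_upperBound (hμ : ∀ l, 0 < μ l) (hsort : Antitone μ) (hlam : 0 < lam)
    (hstable : lam < totalRate μ c) (hπ : IsStationaryDistribution (rate lam μ c) π) :
    ∑' z : State c, (z.total : ℝ) * π z ≤ upperBound lam μ c := by
  have hC := one_le_totalCapacity hlam hstable
  have hd : ∀ n, totalCapacity c ≤ n → slowDeathRate μ c n = totalRate μ c :=
    fun n => slowDeathRate_of_le
  have hd0 : ∀ n, 1 ≤ n → 0 < slowDeathRate μ c n := fun n => slowDeathRate_pos hμ hC
  refine mean_le_of_monotone_ratio (phi_pos hlam hstable hd0)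
    (hasSum_totalProb hπ.2.1) (hasSum_phi hlam hstable hC hd hd0)
    (hasSum_mul_totalProb hμ hlam hstable hπ) (hasSum_mul_phi hlam hstable hd) fun n => ?_
  refine le_of_mul_le_mul_right ?_ hlam
  have h1 := mul_le_mul_of_nonneg_left (totalProb_succ_mul_le hμ hsort hlam hπ n)
    (phi_pos (C := totalCapacity c) hlam hstable hd0 (n + 1)).le
  have h2 := phi_mul_eq (lam := lam) (ν := totalRate μ c) (C := totalCapacity c) hd0 n
  linear_combination h1 + totalProb π (n + 1) * h2

end JFFC

/-! ### Little's law -/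

namespace JFFC

open State

variable {K : ℕ} {μ : Fin K → ℝ} {c : Fin K → ℕ} {lam : ℝ} {π : State c → ℝ}

open Classical in
/-- Mean response time of a job that finds the system in state `z` upon its arrival. -/
noncomputable def meanResponse (μ : Fin K → ℝ) (c : Fin K → ℕ) (z : State c) : ℝ :=
  if h : z.HasFree then 1 / μ (z.fastestFree h)
  else ((z.queue : ℝ) + 1) / totalRate μ c + (totalCapacity c : ℝ) / totalRate μ c

open Classical in
/-- Little's law for the jobs in service on a single chain `l` while the queue is empty: the
number of jobs on chain `l` has mean drift zero. -/
theorem hasSum_chain_balance (hμ : ∀ l, 0 < μ l) (hlam : 0 < lam)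
    (hπ : IsStationaryDistribution (rate lam μ c) π) (l : Fin K) :
    HasSum (fun z => π z * ((if h : z.HasFree then if z.fastestFree h = l then lam / μ l else 0
      else 0) - if z.queue = 0 then (z.jobs l : ℝ) else 0)) 0 := by
  have h := (hasSum_drift hμ hlam hπ (f := fun z => (z.jobs l : ℝ)) (B := c l) fun z => by
    rw [abs_of_nonneg (Nat.cast_nonneg _)]
    exact_mod_cast z.jobs_le l).mul_left (μ l)⁻¹
  rw [mul_zero] at h
  refine h.congr_fun fun z => ?_
  have hμl := (hμ l).ne'
  have h1 : ((z.arrive.jobs l : ℝ) - z.jobs l)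
      = if h : z.HasFree then if z.fastestFree h = l then 1 else 0 else 0 := by
    split_ifs with hz hl
    · subst hl
      simp [jobs_arrive hz]
    · simp [jobs_arrive hz, Ne.symm hl]
    · rw [eq_full hz, arrive_full]
      simp [full]
  have h2 : ∀ k, (z.jobs k : ℝ) * μ k * (((z.complete k).jobs l : ℝ) - z.jobs l)
      = if k = l then if z.queue = 0 then - ((z.jobs l : ℝ) * μ l) else 0 else 0 := fun k => by
    by_cases hq : z.queue = 0
    · rw [jobs_complete hq, if_pos hq]
      split_ifs with hk
      · subst hk
        rw [Function.update_self]
        rcases Nat.eq_zero_or_pos (z.jobs k) with h0 | h0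
        · simp [h0]
        · push_cast [h0]
          ring
      · simp [Function.update_of_ne (Ne.symm hk)]
    · simp [complete, hq]
  rw [h1, Finset.sum_congr rfl fun k _ => h2 k, Finset.sum_ite_eq' Finset.univ l,
    if_pos (Finset.mem_univ l)]
  split_ifs <;> field_simp <;> ring

open Classical in
theorem hasSum_free_balance (hμ : ∀ l, 0 < μ l) (hlam : 0 < lam)
    (hπ : IsStationaryDistribution (rate lam μ c) π) :
    HasSum (fun z => π z * ((if h : z.HasFree then lam / μ (z.fastestFree h) else 0)
      - if z.queue = 0 then (z.total : ℝ) else 0)) 0 := by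
  have h := hasSum_sum fun l (_ : l ∈ Finset.univ) => hasSum_chain_balance hμ hlam hπ l
  rw [Finset.sum_const_zero] at h
  refine h.congr_fun fun z => ?_
  rw [← Finset.mul_sum, Finset.sum_sub_distrib]
  congr 2
  · split_ifs with hz
    · rw [Finset.sum_ite_eq, if_pos (Finset.mem_univ _)]
    · simp
  · split_ifs with hz
    · simp [total, hz]
    · simp

open Classical in
/-- Little's law for the jobs that find all chains occupied. A job arriving when `n` jobs are queued
contributes `(n + 1 + C) / ν`, and `λ π (full n) = ν π (full (n + 1))`. -/
theorem hasSum_full_balance (hμ : ∀ l, 0 < μ l) (hlam : 0 < lam)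
    (hstable : lam < totalRate μ c) (hπ : IsStationaryDistribution (rate lam μ c) π) :
    HasSum (fun z => π z * ((if z.HasFree then 0
      else lam * (((z.queue : ℝ) + 1) / totalRate μ c + (totalCapacity c : ℝ) / totalRate μ c))
      - if z.queue = 0 then 0 else (z.total : ℝ))) 0 := by
  have hν := (hlam.trans hstable).ne'
  have hinj : Function.Injective fun n => full c (n + 1) := fun m n h =>
    Nat.succ_injective (full_injective h)
  have hs := ((summable_total_mul hμ hlam hstable hπ).comp_injective hinj).hasSum
  have h1 : HasSum (fun z => if z.HasFree then 0 else π z * (lam * (((z.queue : ℝ) + 1)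
      / totalRate μ c + (totalCapacity c : ℝ) / totalRate μ c)))
      (∑' n, ((fun z : State c => (z.total : ℝ) * π z) ∘ fun n => full c (n + 1)) n) := by
    refine (full_injective.hasSum_iff fun z hz => if_pos ?_).1 (hs.congr_fun fun n => ?_)
    · by_contra h
      exact hz ⟨_, (eq_full h).symm⟩
    · have h2 := mul_full_succ hμ hlam hπ n
      have h3 : (full c (n + 1)).total = n + 1 + totalCapacity c := rfl
      simp only [Function.comp_apply, if_neg (not_hasFree_full n), h3]
      rw [show (full c n).queue = n from rfl, ← add_div, mul_div_assoc', mul_div_assoc',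
        div_eq_iff hν]
      push_cast
      linear_combination ((n : ℝ) + 1 + totalCapacity c) * h2
  have h2 : HasSum (fun z => if z.queue = 0 then 0 else (z.total : ℝ) * π z)
      (∑' n, ((fun z : State c => (z.total : ℝ) * π z) ∘ fun n => full c (n + 1)) n) := by
    refine (hinj.hasSum_iff fun z hz => if_pos ?_).1 (hs.congr_fun fun n => ?_)
    · by_contra h
      refine hz ⟨z.queue - 1, ?_⟩
      simp only
      rw [Nat.sub_add_cancel (Nat.one_le_iff_ne_zero.2 h), ← eq_full_of_queue_ne_zero h]
    · simp [full]
  have h3 := h1.sub h2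
  rw [sub_self] at h3
  refine h3.congr_fun fun z => ?_
  split_ifs <;> ring

/-- Little's law: the sum of the contributions of the jobs that do and do not find a free chain. -/
theorem hasSum_mul_meanResponse (hμ : ∀ l, 0 < μ l) (hlam : 0 < lam)
    (hstable : lam < totalRate μ c) (hπ : IsStationaryDistribution (rate lam μ c) π) :
    HasSum (fun z => π z * meanResponse μ c z) ((∑' z : State c, (z.total : ℝ) * π z) / lam) := by
  classical
  have h := ((hasSum_free_balance hμ hlam hπ).add (hasSum_full_balance hμ hlam hstable hπ)).add
    (summable_total_mul hμ hlam hstable hπ).hasSum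
  rw [add_zero, zero_add] at h
  refine (h.div_const lam).congr_fun fun z => ?_
  rw [meanResponse]
  split_ifs <;> field_simp <;> ring

end JFFC

/-! ### Laws of random times and their means -/

/-- `P` is the law of a nonnegative random time with finite mean `m`. -/
structure IsTimeLaw (P : Measure ℝ) (m : ℝ) : Prop where
  univ : P Set.univ = 1
  nonneg : ∀ᵐ t ∂P, 0 ≤ t
  mean_nonneg : 0 ≤ m
  lintegral : ∫⁻ t, ENNReal.ofReal t ∂P = ENNReal.ofReal m

namespace IsTimeLaw

variable {P Q : Measure ℝ} {m k : ℝ}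

theorem isProbabilityMeasure (h : IsTimeLaw P m) : IsProbabilityMeasure P := ⟨h.univ⟩

theorem integral_eq (h : IsTimeLaw P m) : ∫ t, t ∂P = m := by
  rw [integral_eq_lintegral_of_nonneg_ae h.nonneg measurable_id.aestronglyMeasurable, h.lintegral,
    ENNReal.toReal_ofReal h.mean_nonneg]

theorem integrable (h : IsTimeLaw P m) : Integrable (fun t : ℝ => t) P := by
  refine ⟨measurable_id.aestronglyMeasurable, ?_⟩
  rw [hasFiniteIntegral_iff_ofReal h.nonneg, h.lintegral]
  exact ENNReal.ofReal_lt_top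

/-- The mean of the Gamma distribution: multiplication of its density by `t` gives, up to the factor
`a / r`, the density with the shape parameter `a + 1`. -/
theorem gamma {a r : ℝ} (ha : 0 < a) (hr : 0 < r) : IsTimeLaw (gammaMeasure a r) (a / r) where
  univ := (isProbabilityMeasure_gammaMeasure ha hr).measure_univ
  nonneg := by
    have hm : Measurable (gammaPDF a r) := (measurable_gammaPDFReal a r).ennreal_ofReal
    rw [gammaMeasure, ae_withDensity_iff hm]
    refine .of_forall fun t ht => ?_
    by_contra! h
    exact ht (gammaPDF_of_neg h)
  mean_nonneg := by positivity
  lintegral := by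
    have hm : ∀ a, Measurable (gammaPDF a r) := fun a =>
      (measurable_gammaPDFReal a r).ennreal_ofReal
    have h1 : ∀ t, gammaPDF a r t * ENNReal.ofReal t
        = ENNReal.ofReal (a / r) * gammaPDF (a + 1) r t := fun t => by
      rcases lt_or_ge t 0 with ht | ht
      · simp [gammaPDF_of_neg ht]
      · rw [gammaPDF, gammaPDF, ← ENNReal.ofReal_mul (gammaPDFReal_nonneg ha hr t),
          ← ENNReal.ofReal_mul (by positivity)]
        congr 1
        rw [gammaPDFReal, gammaPDFReal, if_pos ht, if_pos ht, Real.Gamma_add_one ha.ne',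
          Real.rpow_add_one hr.ne', add_sub_cancel_right]
        have hG := (Real.Gamma_pos_of_pos ha).ne'
        rcases ht.eq_or_lt with rfl | ht
        · rw [Real.zero_rpow ha.ne']
          ring
        · rw [Real.rpow_sub_one ht.ne']
          field_simp
    rw [gammaMeasure, lintegral_withDensity_eq_lintegral_mul _ (hm a) ENNReal.measurable_ofReal]
    simp only [Pi.mul_apply, h1]
    rw [lintegral_const_mul _ (hm _), lintegral_gammaPDF_eq_one (by linarith) hr, mul_one]

theorem exp {r : ℝ} (hr : 0 < r) : IsTimeLaw (expMeasure r) (1 / r) := gamma one_pos hr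

theorem conv (hP : IsTimeLaw P m) (hQ : IsTimeLaw Q k) : IsTimeLaw (P.conv Q) (m + k) := by
  have := hP.isProbabilityMeasure
  have := hQ.isProbabilityMeasure
  refine ⟨measure_univ, ?_, add_nonneg hP.mean_nonneg hQ.mean_nonneg, ?_⟩
  · rw [Measure.conv, ae_map_iff (by fun_prop) measurableSet_Ici]
    have h1 := Measure.quasiMeasurePreserving_fst (μ := P) (ν := Q) |>.ae hP.nonneg
    have h2 := Measure.quasiMeasurePreserving_snd (μ := P) (ν := Q) |>.ae hQ.nonneg
    filter_upwards [h1, h2] with t ht1 ht2 using add_nonneg ht1 ht2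
  · rw [Measure.lintegral_conv ENNReal.measurable_ofReal]
    have h1 : ∀ᵐ s ∂P, ∫⁻ t, ENNReal.ofReal (s + t) ∂Q = ENNReal.ofReal s + ENNReal.ofReal k := by
      filter_upwards [hP.nonneg] with s hs
      have h2 : ∀ᵐ t ∂Q, ENNReal.ofReal (s + t) = ENNReal.ofReal s + ENNReal.ofReal t := by
        filter_upwards [hQ.nonneg] with t ht using ENNReal.ofReal_add hs ht
      rw [lintegral_congr_ae h2, lintegral_add_left measurable_const, lintegral_const,
        measure_univ, mul_one, hQ.lintegral]
    rw [lintegral_congr_ae h1, lintegral_add_right _ measurable_const, lintegral_const,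
      measure_univ, mul_one, hP.lintegral, ENNReal.ofReal_add hP.mean_nonneg hQ.mean_nonneg]

/-- The mean of a countable mixture. -/
theorem sum {ι : Type*} [Countable ι] {p : ι → Measure ℝ} {w b : ι → ℝ} {M : ℝ}
    (hp : ∀ i, IsTimeLaw (p i) (b i)) (hw : ∀ i, 0 ≤ w i)
    (hw1 : HasSum w 1) (hM : HasSum (fun i => w i * b i) M) :
    IsTimeLaw (Measure.sum fun i => ENNReal.ofReal (w i) • p i) M where
  univ := by
    rw [Measure.sum_apply _ MeasurableSet.univ, ← ENNReal.ofReal_one, ← hw1.tsum_eq,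
      ENNReal.ofReal_tsum_of_nonneg hw hw1.summable]
    refine tsum_congr fun i => ?_
    simp [(hp i).univ]
  nonneg := Measure.ae_sum_iff.2 fun i => Measure.ae_smul_measure (hp i).nonneg _
  mean_nonneg := hM.nonneg fun i => mul_nonneg (hw i) (hp i).mean_nonneg
  lintegral := by
    rw [lintegral_sum_measure, ← hM.tsum_eq,
      ENNReal.ofReal_tsum_of_nonneg (fun i => mul_nonneg (hw i) (hp i).mean_nonneg) hM.summable]
    refine tsum_congr fun i => ?_
    rw [lintegral_smul_measure, ENNReal.ofReal_mul (hw i), smul_eq_mul, (hp i).lintegral]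

end IsTimeLaw

/-! ### Response times and conclusion -/

namespace JFFC

open State

variable {K : ℕ} {μ : Fin K → ℝ} {c : Fin K → ℕ} {lam : ℝ} {π : State c → ℝ}

instance : Countable (State c) :=
  Function.Injective.countable (f := fun z : State c => (z.queue, z.jobs)) fun _ _ h =>
    State.ext (Prod.ext_iff.1 h).1 (Prod.ext_iff.1 h).2

theorem isTimeLaw_responseLaw (hμ : ∀ l, 0 < μ l) (hν : 0 < totalRate μ c) (z : State c) :
    IsTimeLaw (responseLaw μ c z) (meanResponse μ c z) := by
  classical
  rw [responseLaw, meanResponse]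
  split_ifs with h
  · exact .exp (hμ _)
  refine (IsTimeLaw.gamma (by positivity) hν).conv ?_
  rw [← Measure.sum_fintype]
  refine .sum (b := fun l => 1 / μ l) (fun l => .exp (hμ l))
    (fun l => div_nonneg (mul_nonneg (Nat.cast_nonneg _) (hμ l).le) hν.le) ?_ ?_
  · refine hasSum_of_sum_eq Finset.univ (by simp) ?_
    rw [← Finset.sum_div]
    exact div_self hν.ne'
  · refine hasSum_of_sum_eq Finset.univ (by simp) ?_
    rw [totalCapacity, Nat.cast_sum, Finset.sum_div]
    refine Finset.sum_congr rfl fun l _ => ?_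
    have := (hμ l).ne'
    field_simp

theorem isTimeLaw_steadyResponseLaw (hμ : ∀ l, 0 < μ l) (hlam : 0 < lam)
    (hstable : lam < totalRate μ c) (hπ : IsStationaryDistribution (rate lam μ c) π) :
    IsTimeLaw (steadyResponseLaw μ c π) ((∑' z : State c, (z.total : ℝ) * π z) / lam) :=
  .sum (isTimeLaw_responseLaw hμ (hlam.trans hstable)) hπ.1 hπ.2.1
    (hasSum_mul_meanResponse hμ hlam hstable hπ)

end JFFC

theorem mainTheorem1 {K : ℕ} (μ : Fin K → ℝ) (c : Fin K → ℕ) (lam : ℝ)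
    (hμ_pos : ∀ l, 0 < μ l) (hμ_sorted : Antitone μ) (hlam : 0 < lam)
    (hstable : lam < JFFC.totalRate μ c) :
    -- the two birth–death processes, their stationary distributions and stationary means
    (∃! φ : ℕ → ℝ, IsStationaryDistribution (birthDeathRate lam (JFFC.fastDeathRate μ c)) φ) ∧
    (∀ φ : ℕ → ℝ, IsStationaryDistribution (birthDeathRate lam (JFFC.fastDeathRate μ c)) φ →
      (∀ n ≤ JFFC.totalCapacity c, φ n = JFFC.phi lam (JFFC.totalRate μ c) (JFFC.totalCapacity c)
           (JFFC.fastDeathRate μ c) n) ∧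
      HasSum (fun n : ℕ => (n : ℝ) * φ n) (JFFC.lowerBound lam μ c)) ∧
    (∃! φ : ℕ → ℝ, IsStationaryDistribution (birthDeathRate lam (JFFC.slowDeathRate μ c)) φ) ∧
    (∀ φ : ℕ → ℝ, IsStationaryDistribution (birthDeathRate lam (JFFC.slowDeathRate μ c)) φ →
      (∀ n ≤ JFFC.totalCapacity c, φ n = JFFC.phi lam (JFFC.totalRate μ c) (JFFC.totalCapacity c)
           (JFFC.slowDeathRate μ c) n) ∧
      HasSum (fun n : ℕ => (n : ℝ) * φ n) (JFFC.upperBound lam μ c)) ∧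
    -- the steady state of the system under Join-the-Fastest-Free-Chain
    (∃! π : JFFC.State c → ℝ, IsStationaryDistribution (JFFC.rate lam μ c) π) ∧
    (∀ π : JFFC.State c → ℝ, IsStationaryDistribution (JFFC.rate lam μ c) π →
      -- bounds on the mean number of jobs in the system
      Summable (fun z => (z.total : ℝ) * π z) ∧
      JFFC.lowerBound lam μ c ≤ ∑' z, (z.total : ℝ) * π z ∧
      ∑' z, (z.total : ℝ) * π z ≤ JFFC.upperBound lam μ c ∧
      -- Little's law and bounds on the mean response time
      IsProbabilityMeasure (JFFC.steadyResponseLaw μ c π) ∧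
      MeasureTheory.Integrable (fun t : ℝ => t) (JFFC.steadyResponseLaw μ c π) ∧
      ∫ t, t ∂(JFFC.steadyResponseLaw μ c π) = (∑' z, (z.total : ℝ) * π z) / lam ∧
      JFFC.lowerBound lam μ c / lam ≤ ∫ t, t ∂(JFFC.steadyResponseLaw μ c π) ∧
      ∫ t, t ∂(JFFC.steadyResponseLaw μ c π) ≤ JFFC.upperBound lam μ c / lam) := by
  have hC := JFFC.one_le_totalCapacity hlam hstable
  have hfast : ∀ φ, IsStationaryDistribution (birthDeathRate lam (JFFC.fastDeathRate μ c)) φ ↔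
      φ = JFFC.phi lam (JFFC.totalRate μ c) (JFFC.totalCapacity c) (JFFC.fastDeathRate μ c) :=
    fun φ => isStationaryDistribution_birthDeathRate_iff_eq_phi hlam hstable hC
      (fun _ => JFFC.fastDeathRate_of_le) (fun _ => JFFC.fastDeathRate_pos hμ_pos hC)
  have hslow : ∀ φ, IsStationaryDistribution (birthDeathRate lam (JFFC.slowDeathRate μ c)) φ ↔
      φ = JFFC.phi lam (JFFC.totalRate μ c) (JFFC.totalCapacity c) (JFFC.slowDeathRate μ c) :=
    fun φ => isStationaryDistribution_birthDeathRate_iff_eq_phi hlam hstable hC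
      (fun _ => JFFC.slowDeathRate_of_le) (fun _ => JFFC.slowDeathRate_pos hμ_pos hC)
  refine ⟨⟨_, (hfast _).2 rfl, fun φ => (hfast φ).1⟩, fun φ hφ => ?_,
    ⟨_, (hslow _).2 rfl, fun φ => (hslow φ).1⟩, fun φ hφ => ?_,
    JFFC.existsUnique_isStationaryDistribution hμ_pos hlam hstable, fun π hπ => ?_⟩
  · obtain rfl := (hfast φ).1 hφ
    exact ⟨fun _ _ => rfl, hasSum_mul_phi hlam hstable fun _ => JFFC.fastDeathRate_of_le⟩
  · obtain rfl := (hslow φ).1 hφ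
    exact ⟨fun _ _ => rfl, hasSum_mul_phi hlam hstable fun _ => JFFC.slowDeathRate_of_le⟩
  · have hT := JFFC.isTimeLaw_steadyResponseLaw hμ_pos hlam hstable hπ
    have hlow := JFFC.lowerBound_le hμ_pos hμ_sorted hlam hstable hπ
    have hup := JFFC.le_upperBound hμ_pos hμ_sorted hlam hstable hπ
    refine ⟨JFFC.summable_total_mul hμ_pos hlam hstable hπ, hlow, hup,
      hT.isProbabilityMeasure, hT.integrable, hT.integral_eq, ?_, ?_⟩ <;> rw [hT.integral_eq]
    · exact div_le_div_of_nonneg_right hlow hlam.le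
    · exact div_le_div_of_nonneg_right hup hlam.le
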